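/- **Theorem (Second Restriction Theorem).** For a finite-dimensional real vector space $V$ put $\mathbf J^2(V)=\mathbb R\times V^*\times \mathrm{Sym}^2(V^*)$, with elements $(r,p,A)$. A set $\mathbf F\subset\mathbf J^2(V)$ is a *constant coefficient subequation* if it is closed and satisfies (P): $(r,p,A)\in\mathbf F$ and $P\ge 0$ imply $(r,p,A+P)\in\mathbf F$. For a smooth manifold $M$ let $J^2(M)$ be the bundle of 2-jets of functions; local coordinates on $U\subset M$ with values in $V$ trivialize it as $J^2(U)=U\times\mathbf J^2(V)$ via $J_xu\mapsto(u,Du,D^2u)(x)$. A *subequation* on $M$ is a closed set $F\subset J^2(M)$ whose fibres satisfy (P). An upper semicontinuous $u:M\to[-\infty,\infty)$ is *$F$-subharmonic* if for every $x_0\in M$ and every function $\varphi$ that is $C^2$ near $x_0$ with $u\le\varphi$ near $x_0$ and $u(x_0)=\varphi(x_0)$, the 2-jet of $\varphi$ at $x_0$ lies in $F$. An *automorphism* of $J^2(U)$ is a smooth vector bundle isomorphism $\Phi$ that is the identity on the 0-jet factor $\mathbb R$ times an isomorphism of the reduced jet bundle which maps the subbundle $\mathrm{Sym}^2(T^*U)$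 to itself by $\Phi(A)=hAh^t$ for some smooth bundle isomorphism $h$ of $T^*U$. A subequation $F$ on $M$ is *locally jet equivalent to* the constant coefficient subequation $\mathbf F$ if each point of $M$ has a coordinate neighbourhood $U$ and an automorphism $\Phi$ of $J^2(U)$ with $\Phi(F|_U)=U\times\mathbf F$ in those coordinates. Let $i:X\hookrightarrow Z$ be an embedded submanifold of a smooth manifold, $\dim X=n$, $\dim Z=n+m$, and let $i_X^*:J^2_{i(x)}(Z)\to J^2_x(X)$ be the restriction of 2-jets, $J_{i(x)}f\mapsto J_x(f\circ i)$. In coordinates it is modelled by $i^*:\mathbf J^2(\mathbb R^n\times\mathbb R^m)\to\mathbf J^2(\mathbb R^n)$, $$i^*\left(r,(p,q),\begin{pmatrix}A&C\\ C^t&B\end{pmatrix}\right)=(r,p,A).$$ A subequation $F\subset J^2(Z)$ is *locally jet equivalent modulo $X$ to* the constant coefficient subequation $\mathbf F\subset\mathbf J^2(\mathbb R^n\times\mathbb R^m)$ if each point of $X$ has a neighbourhood $U$ in $Z$ with coordinates $z=(x,y)\in\mathbb R^n\times\mathbb R^m$ in which $X\cap U=\{y=y_0\}$, and an automorphism $\Phi$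 of $J^2(U)$ with $\Phi(F|_U)=U\times\mathbf F$ in those coordinates, such that over $X\cap U$ one has $i^*\circ\Phi=\varphi\circ i^*$ for some automorphism $\varphi$ of $J^2(X\cap U)$. Suppose the subequation $F\subset J^2(Z)$ is locally jet equivalent modulo $X$ to a constant coefficient subequation $\mathbf F\subset\mathbf J^2(\mathbb R^n\times\mathbb R^m)$, and suppose that $\mathbf H=i^*\mathbf F$ is a closed set. Let $H=i_X^*F\subset J^2(X)$, that is, $H_x=i_X^*(F_{i(x)})$ for $x\in X$. Then $\mathbf H$ is a constant coefficient subequation, $H$ is a subequation on $X$, $H$ is locally jet equivalent to $\mathbf H$, and restriction holds: for every $F$-subharmonic function $u$ on $Z$, the restriction $u|_X$ is $H$-subharmonic on $X$. -/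

import Mathlib

open scoped Manifold ContDiff Topology

noncomputable section

namespace JetRestriction

/-! ### The model fibre of the 2-jet bundle -/

section Model

variable {V W : Type*} [NormedAddCommGroup V] [NormedSpace ℝ V]
  [NormedAddCommGroup W] [NormedSpace ℝ W]

/-- The symmetric bilinear forms, as a subspace of all bilinear forms on `V`. -/
def symSubmodule (V : Type*) [NormedAddCommGroup V] [NormedSpace ℝ V] :
    @Submodule ℝ (V →L[ℝ] V →L[ℝ] ℝ) _ NormedAddCommGroup.toAddCommGroup.toAddCommMonoid
      NormedSpace.toModule where
  carrier := {A | ∀ v w, A v w = A w v}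
  add_mem' := fun {A B} hA hB v w => by
    change A v w + B v w = A w v + B w v
    rw [hA v w, hB v w]
  zero_mem' := fun v w => rfl
  smul_mem' := fun c A hA v w => by
    change c * A v w = c * A w v
    rw [hA v w]

/-- `Sym²(V*)`: the normed space of symmetric bilinear forms on `V`. -/
def SymForm (V : Type*) [NormedAddCommGroup V] [NormedSpace ℝ V] : Type _ := ↥(symSubmodule V)

instance SymForm.instNormedAddCommGroup : NormedAddCommGroup (SymForm V) :=
  inferInstanceAs (NormedAddCommGroup ↥(symSubmodule V))

instance SymForm.instNormedSpace : NormedSpace ℝ (SymForm V) :=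
  inferInstanceAs (NormedSpace ℝ ↥(symSubmodule V))

/-- The bilinear form underlying an element of `Sym²(V*)`. -/
def SymForm.form : SymForm V →L[ℝ] V →L[ℝ] V →L[ℝ] ℝ := (symSubmodule V).subtypeL

/-- Pull-back of a symmetric form along a linear map: `(ℓ* A)(v, w) = A (ℓ v, ℓ w)`. -/
def SymForm.pull (ℓ : V →L[ℝ] W) (A : SymForm W) : SymForm V :=
  (⟨A.form.bilinearComp ℓ ℓ, fun v w => A.2 (ℓ v) (ℓ w)⟩ : ↥(symSubmodule V))

/-- `A ≥ 0` as a quadratic form. -/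
def SymForm.IsNonneg (A : SymForm V) : Prop := ∀ v, 0 ≤ A.form v v

/-- The reduced 2-jets `(p, A)` with constant coefficients, `V* × Sym²(V*)`. -/
abbrev RedJet (V : Type*) [NormedAddCommGroup V] [NormedSpace ℝ V] : Type _ :=
  (V →L[ℝ] ℝ) × SymForm V

/-- The space `𝐉²(V) = ℝ × V* × Sym²(V*)` of 2-jets `(r, p, A)`. -/
abbrev JetModel (V : Type*) [NormedAddCommGroup V] [NormedSpace ℝ V] : Type _ :=
  ℝ × RedJet V

/-- The positivity condition (P) on a set of jets: `S + 𝒫 ⊆ S`. -/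
def PosCondition (S : Set (JetModel V)) : Prop :=
  ∀ (r : ℝ) (p : V →L[ℝ] ℝ) (A P : SymForm V),
    (r, p, A) ∈ S → P.IsNonneg → (r, p, A + P) ∈ S

/-- A constant coefficient subequation: a closed set of jets satisfying (P). -/
def IsConstSubequation (S : Set (JetModel V)) : Prop :=
  IsClosed S ∧ PosCondition S

/-- Restriction of 2-jets from `V × W` to the `V`-directions:
`i* (r, (p, q), (A, C; Cᵗ, B)) = (r, p, A)`. -/
def restrictModel (J : JetModel (V × W)) : JetModel V :=
  (J.1, J.2.1.comp (ContinuousLinearMap.inl ℝ V W),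
    J.2.2.pull (ContinuousLinearMap.inl ℝ V W))

/-- The fibrewise action on full jets `(r, j)` of an automorphism of reduced jets: it is the
identity on the 0-jet factor. -/
def actJet (Φ : RedJet V ≃L[ℝ] RedJet V) (J : JetModel V) : JetModel V :=
  (J.1, Φ J.2)

/-- A (smooth) automorphism of the jet bundle over the open set `D ⊆ V`, where the bundle of reduced
jets is canonically trivialised as `D × RedJet V`: a smooth family of linear isomorphisms `Φ x` that
map the subbundle `Sym²` to itself through a smooth bundle isomorphism `h` of the cotangent bundle,
`Φ x A = h A hᵗ`, i.e. `(Φ x A)(v, w) = A (hᵗ v, hᵗ w)`.  The family `k` below is `hᵗ`. -/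
def IsJetAutomorphism (D : Set V) (Φ : V → RedJet V ≃L[ℝ] RedJet V) : Prop :=
  ContDiffOn ℝ ∞ (fun x => (Φ x : RedJet V →L[ℝ] RedJet V)) D ∧
  ∃ k : V → V ≃L[ℝ] V,
    ContDiffOn ℝ ∞ (fun x => (k x : V →L[ℝ] V)) D ∧
    ∀ x ∈ D, ∀ A : SymForm V, Φ x (0, A) = (0, A.pull (k x : V →L[ℝ] V))

/-- An automorphism `Φ` over the open set `D ⊆ V × W` is a relative automorphism with respect to
the slice `{y = y₀}` if on the slice it covers, via restriction of jets, an automorphism `φ` of the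
jet bundle of the slice: `i* ∘ Φ = φ ∘ i*`. -/
def IsRelativeJetAutomorphism (D : Set (V × W)) (y₀ : W)
    (Φ : V × W → RedJet (V × W) ≃L[ℝ] RedJet (V × W)) : Prop :=
  IsJetAutomorphism D Φ ∧
  ∃ φ : V → RedJet V ≃L[ℝ] RedJet V,
    IsJetAutomorphism {x | (x, y₀) ∈ D} φ ∧
    ∀ x, (x, y₀) ∈ D → ∀ J : JetModel (V × W),
      restrictModel (actJet (Φ (x, y₀)) J) = actJet (φ x) (restrictModel J)

theorem two_le_infty : (2 : WithTop ℕ∞) ≤ ∞ := by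
  have h : ((2 : ℕ∞) : WithTop ℕ∞) ≤ ((⊤ : ℕ∞) : WithTop ℕ∞) := WithTop.coe_le_coe.2 le_top
  exact h

/-- Value, first and second derivative of `f` at `x`. -/
def derivs (f : V → ℝ) (x : V) : ℝ × (V →L[ℝ] ℝ) × (V →L[ℝ] V →L[ℝ] ℝ) :=
  (f x, fderiv ℝ f x, fderiv ℝ (fderiv ℝ f) x)

theorem derivs_congr {f g : V → ℝ} {x : V} (h : f =ᶠ[𝓝 x] g) : derivs f x = derivs g x := by
  simp only [derivs, h.eq_of_nhds, h.fderiv_eq, h.fderiv.fderiv_eq]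

/-- Chain rule: the derivatives up to order two of `f ∘ τ` depend only on those of `f`. -/
theorem derivs_comp {f g : W → ℝ} {τ : V → W} {x : V}
    (hf : ContDiffAt ℝ 2 f (τ x)) (hg : ContDiffAt ℝ 2 g (τ x)) (hτ : ContDiffAt ℝ 2 τ x)
    (h : derivs f (τ x) = derivs g (τ x)) : derivs (f ∘ τ) x = derivs (g ∘ τ) x := by
  have key : ∀ {f : W → ℝ}, ContDiffAt ℝ 2 f (τ x) →
      fderiv ℝ (f ∘ τ) x = (fderiv ℝ f (τ x)).comp (fderiv ℝ τ x) ∧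
      fderiv ℝ (fderiv ℝ (f ∘ τ)) x =
        (ContinuousLinearMap.compL ℝ V W ℝ (fderiv ℝ f (τ x))).comp (fderiv ℝ (fderiv ℝ τ) x) +
        ((ContinuousLinearMap.compL ℝ V W ℝ).flip (fderiv ℝ τ x)).comp
          ((fderiv ℝ (fderiv ℝ f) (τ x)).comp (fderiv ℝ τ x)) := by
    intro f hf
    have h1 : ∀ᶠ y in 𝓝 x, fderiv ℝ (f ∘ τ) y = (fderiv ℝ f (τ y)).comp (fderiv ℝ τ y) := by
      have hf1 : ∀ᶠ z in 𝓝 (τ x), ContDiffAt ℝ 2 f z := hf.eventually (by simp)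
      filter_upwards [hτ.eventually (by simp), hτ.continuousAt.eventually hf1] with y hy hy'
      exact fderiv_comp y (hy'.differentiableAt (by simp)) (hy.differentiableAt (by simp))
    refine ⟨h1.self_of_nhds, ?_⟩
    have h1' : fderiv ℝ (f ∘ τ) =ᶠ[𝓝 x] fun y => (fderiv ℝ f (τ y)).comp (fderiv ℝ τ y) := h1
    rw [h1'.fderiv_eq]
    have hdf : DifferentiableAt ℝ (fderiv ℝ f) (τ x) :=
      (hf.fderiv_right (m := 1) (by norm_num)).differentiableAt (by simp)
    have hdτ : DifferentiableAt ℝ (fderiv ℝ τ) x :=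
      (hτ.fderiv_right (m := 1) (by norm_num)).differentiableAt (by simp)
    have hc : HasFDerivAt (fun y => fderiv ℝ f (τ y))
        ((fderiv ℝ (fderiv ℝ f) (τ x)).comp (fderiv ℝ τ x)) x :=
      hdf.hasFDerivAt.comp x (hτ.differentiableAt (by simp)).hasFDerivAt
    exact (hc.clm_comp hdτ.hasFDerivAt).fderiv
  simp only [derivs, Prod.mk.injEq] at h ⊢
  obtain ⟨h0, h1, h2⟩ := h
  obtain ⟨a1, a2⟩ := key hf
  obtain ⟨b1, b2⟩ := key hg
  refine ⟨h0, ?_, ?_⟩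
  · rw [a1, b1, h1]
  · rw [a2, b2, h1, h2]

end Model

/-! ### The 2-jet bundle of a manifold -/

section Jets

variable (E : Type*) [NormedAddCommGroup E] [NormedSpace ℝ E]
  {M : Type*} [TopologicalSpace M] [ChartedSpace E M]

/-- Functions of class `C²` near `z`. -/
def C2At (z : M) : Type _ := {f : M → ℝ // ContMDiffAt 𝓘(ℝ, E) 𝓘(ℝ, ℝ) 2 f z}

/-- Two functions have the same 2-jet at `z` if their value, first and second derivatives at `z`
agree in a chart (by the chain rule the chart is irrelevant). -/
def jetSetoid (z : M) : Setoid (C2At E z) where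
  r f g := derivs (f.1 ∘ (chartAt E z).symm) (chartAt E z z) =
    derivs (g.1 ∘ (chartAt E z).symm) (chartAt E z z)
  iseqv := ⟨fun _ => rfl, fun h => h.symm, fun h h' => h.trans h'⟩

/-- The fibre `J²_z(M)`: 2-jets at `z` of functions that are `C²` near `z`. -/
def Jet (z : M) : Type _ := Quotient (jetSetoid E z)

variable (M) in
/-- The total space of the 2-jet bundle `J²(M)`. -/
def JetBundle : Type _ := Σ z : M, Jet E z

/-- The 2-jet at `z` of a function of class `C²` near `z`. -/
def jet (f : M → ℝ) (z : M) (hf : ContMDiffAt 𝓘(ℝ, E) 𝓘(ℝ, ℝ) 2 f z) : JetBundle E M :=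
  ⟨z, Quotient.mk (jetSetoid E z) ⟨f, hf⟩⟩

variable (M) in
/-- A smooth local coordinate system on `M` with values in `V`: a diffeomorphism of an open subset
of `M` onto an open subset of `V`. -/
structure LocalCoord (V : Type*) [NormedAddCommGroup V] [NormedSpace ℝ V] where
  /-- the coordinate map -/
  toHomeo : OpenPartialHomeomorph M V
  smooth : ContMDiffOn 𝓘(ℝ, E) 𝓘(ℝ, V) ∞ toHomeo toHomeo.source
  smooth_symm : ContMDiffOn 𝓘(ℝ, V) 𝓘(ℝ, E) ∞ toHomeo.symm toHomeo.target

variable {E} {V : Type*} [NormedAddCommGroup V] [NormedSpace ℝ V]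

/-- The quadratic polynomial on `V` with 2-jet `J` at `x`. -/
def quadPoly (x : V) (J : JetModel V) (v : V) : ℝ :=
  J.1 + J.2.1 (v - x) + (1 / 2) * J.2.2.form (v - x) (v - x)

theorem quadPoly_contDiff (x : V) (J : JetModel V) : ContDiff ℝ ∞ (quadPoly x J) := by
  unfold quadPoly
  have h : ContDiff ℝ ∞ (fun v : V => v - x) := contDiff_id.sub contDiff_const
  exact (contDiff_const.add (J.2.1.contDiff.comp h)).add
    (contDiff_const.mul ((J.2.2.form.contDiff.comp h).clm_apply h))

theorem LocalCoord.contMDiffAt_quadPoly (e : LocalCoord E M V) (x : e.toHomeo.target)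
    (J : JetModel V) :
    ContMDiffAt 𝓘(ℝ, E) 𝓘(ℝ, ℝ) 2 (quadPoly (x : V) J ∘ e.toHomeo) (e.toHomeo.symm x) := by
  have h1 : ContMDiffAt 𝓘(ℝ, E) 𝓘(ℝ, V) ∞ e.toHomeo (e.toHomeo.symm x) :=
    e.smooth.contMDiffAt (e.toHomeo.open_source.mem_nhds (e.toHomeo.map_target x.2))
  have h2 : ContMDiffAt 𝓘(ℝ, V) 𝓘(ℝ, ℝ) ∞ (quadPoly (x : V) J)
      (e.toHomeo (e.toHomeo.symm x)) := (quadPoly_contDiff (x : V) J).contMDiff.contMDiffAt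
  exact (h2.comp _ h1).of_le two_le_infty

/-- The canonical trivialisation of the jet bundle over a coordinate domain `U`: the jet over the
point with coordinates `x` whose coordinate expression `(u, Du, D²u)` at `x` is `J`. -/
def LocalCoord.jetOf (e : LocalCoord E M V) (x : e.toHomeo.target) (J : JetModel V) :
    JetBundle E M :=
  jet E (quadPoly (x : V) J ∘ e.toHomeo) (e.toHomeo.symm x) (e.contMDiffAt_quadPoly x J)

/-- The topology of `J²(M)`: the final topology for the canonical trivialisations
`e(U) × 𝐉²(E) → J²(M)` over all coordinate systems. -/
instance JetBundle.instTopologicalSpace : TopologicalSpace (JetBundle E M) :=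
  ⨆ e : LocalCoord E M E,
    TopologicalSpace.coinduced
      (fun q : e.toHomeo.target × JetModel E => e.jetOf q.1 q.2) inferInstance

/-- The coordinate expression, at the point with coordinates `x`, of the fibre of `F ⊆ J²(M)`. -/
def fibre (F : Set (JetBundle E M)) (e : LocalCoord E M V) (x : e.toHomeo.target) :
    Set (JetModel V) :=
  {J | e.jetOf x J ∈ F}

/-- A subequation on `M`: a closed subset of `J²(M)` all of whose fibres satisfy (P). -/
def IsSubequation (F : Set (JetBundle E M)) : Prop :=
  IsClosed F ∧ ∀ (e : LocalCoord E M E) (x : e.toHomeo.target), PosCondition (fibre F e x)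

/-- `u` is `F`-subharmonic: `u` is upper semicontinuous with values in `[-∞, ∞)`, and the 2-jet at
`z` of every test function for `u` at `z` belongs to `F`, for all `z`. -/
def IsSubharmonic (F : Set (JetBundle E M)) (u : M → EReal) : Prop :=
  UpperSemicontinuous u ∧ (∀ z, u z < ⊤) ∧
  ∀ (z : M) (φ : M → ℝ) (hφ : ContMDiffAt 𝓘(ℝ, E) 𝓘(ℝ, ℝ) 2 φ z),
    (∀ᶠ w in 𝓝 z, u w ≤ (φ w : EReal)) → u z = (φ z : EReal) → jet E φ z hφ ∈ F

/-- `F` is locally jet equivalent to the constant coefficient subequation `S`: every point has a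
coordinate neighbourhood `U` and an automorphism of `J²(U)` carrying `F` over `U` to `U × S`. -/
def LocallyJetEquivalent (F : Set (JetBundle E M)) (S : Set (JetModel V)) : Prop :=
  ∀ z : M, ∃ e : LocalCoord E M V, z ∈ e.toHomeo.source ∧
    ∃ Φ : V → RedJet V ≃L[ℝ] RedJet V, IsJetAutomorphism e.toHomeo.target Φ ∧
      ∀ (x : e.toHomeo.target) (J : JetModel V), J ∈ fibre F e x ↔ actJet (Φ x) J ∈ S

end Jets

/-! ### Restriction to a submanifold -/

section Restriction

variable {E₁ E₂ : Type*} [NormedAddCommGroup E₁] [NormedSpace ℝ E₁]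
  [NormedAddCommGroup E₂] [NormedSpace ℝ E₂]
  {X Z : Type*} [TopologicalSpace X] [ChartedSpace E₁ X] [TopologicalSpace Z] [ChartedSpace E₂ Z]

theorem derivs_pullback [IsManifold 𝓘(ℝ, E₁) ∞ X] [IsManifold 𝓘(ℝ, E₂) ∞ Z] {i : X → Z}
    (hi : ContMDiff 𝓘(ℝ, E₁) 𝓘(ℝ, E₂) ∞ i) (x : X) {f g : Z → ℝ}
    (hf : ContMDiffAt 𝓘(ℝ, E₂) 𝓘(ℝ, ℝ) 2 f (i x)) (hg : ContMDiffAt 𝓘(ℝ, E₂) 𝓘(ℝ, ℝ) 2 g (i x))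
    (h : derivs (f ∘ (chartAt E₂ (i x)).symm) (chartAt E₂ (i x) (i x)) =
      derivs (g ∘ (chartAt E₂ (i x)).symm) (chartAt E₂ (i x) (i x))) :
    derivs ((f ∘ i) ∘ (chartAt E₁ x).symm) (chartAt E₁ x x) =
      derivs ((g ∘ i) ∘ (chartAt E₁ x).symm) (chartAt E₁ x x) := by
  set c := chartAt E₁ x
  set d := chartAt E₂ (i x)
  set τ : E₁ → E₂ := d ∘ i ∘ c.symm with hτdef
  have hx : c.symm (c x) = x := c.left_inv (mem_chart_source E₁ x)
  have hτx : τ (c x) = d (i x) := by simp [hτdef, hx]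
  have hτ : ContDiffAt ℝ 2 τ (c x) := by
    have h' : ContDiffAt ℝ ∞ τ (c x) := by
      rw [← contDiffWithinAt_univ]
      simpa [extChartAt, τ, c, d] using (contMDiffAt_iff.1 (hi x)).2
    exact h'.of_le two_le_infty
  have chart : ∀ {k : Z → ℝ}, ContMDiffAt 𝓘(ℝ, E₂) 𝓘(ℝ, ℝ) 2 k (i x) →
      ContDiffAt ℝ 2 (k ∘ d.symm) (τ (c x)) := by
    intro k hk
    rw [hτx, ← contDiffWithinAt_univ]
    simpa [extChartAt, chartAt_self_eq, d] using (contMDiffAt_iff.1 hk).2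
  have ev : ∀ k : Z → ℝ, (k ∘ i) ∘ c.symm =ᶠ[𝓝 (c x)] (k ∘ d.symm) ∘ τ := by
    intro k
    have hc : ContinuousAt (i ∘ c.symm) (c x) := by
      refine ContinuousAt.comp hi.continuous.continuousAt ?_
      exact c.continuousAt_symm (c.map_source (mem_chart_source E₁ x))
    have hmem : ∀ᶠ y in 𝓝 (c x), (i ∘ c.symm) y ∈ d.source := by
      refine hc.eventually (d.open_source.mem_nhds ?_)
      simp only [Function.comp_apply, hx]
      exact mem_chart_source E₂ (i x)
    filter_upwards [hmem] with y hy
    simp only [Function.comp_apply, hτdef] at hy ⊢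
    rw [d.left_inv hy]
  rw [derivs_congr (ev f), derivs_congr (ev g)]
  exact derivs_comp (chart hf) (chart hg) hτ (by rw [hτx]; exact h)

/-- Restriction of 2-jets, `i* : J²_{i(x)}(Z) → J²_x(X)`, induced by `f ↦ f ∘ i`. -/
def pullJet [IsManifold 𝓘(ℝ, E₁) ∞ X] [IsManifold 𝓘(ℝ, E₂) ∞ Z] (i : X → Z)
    (hi : ContMDiff 𝓘(ℝ, E₁) 𝓘(ℝ, E₂) ∞ i) (x : X) : Jet E₂ (i x) → Jet E₁ x :=
  Quotient.map' (s₁ := jetSetoid E₂ (i x)) (s₂ := jetSetoid E₁ x)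
    (fun f => ⟨f.1 ∘ i, f.2.comp x ((hi x).of_le two_le_infty)⟩)
    (fun f g h => derivs_pullback hi x f.2 g.2 h)

/-- The restriction `H = i* F` of `F ⊆ J²(Z)` to `X`: `H_x = i* (F_{i(x)})`. -/
def restrictSet [IsManifold 𝓘(ℝ, E₁) ∞ X] [IsManifold 𝓘(ℝ, E₂) ∞ Z] (i : X → Z)
    (hi : ContMDiff 𝓘(ℝ, E₁) 𝓘(ℝ, E₂) ∞ i) (F : Set (JetBundle E₂ Z)) : Set (JetBundle E₁ X) :=
  {q | ∃ j : Jet E₂ (i q.1), (⟨i q.1, j⟩ : JetBundle E₂ Z) ∈ F ∧ pullJet i hi q.1 j = q.2}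

variable {V W : Type*} [NormedAddCommGroup V] [NormedSpace ℝ V]
  [NormedAddCommGroup W] [NormedSpace ℝ W]

/-- Coordinates `z = (x, y)` on `U ⊆ Z` are adapted to `X` if `X ∩ U = {y = y₀}`. -/
def IsAdapted (i : X → Z) (e : LocalCoord E₂ Z (V × W)) (y₀ : W) : Prop :=
  ∀ z ∈ e.toHomeo.source, z ∈ Set.range i ↔ (e.toHomeo z).2 = y₀

/-- `F ⊆ J²(Z)` is locally jet equivalent modulo `X` to the constant coefficient subequation `S`:
every point of `X` has an adapted coordinate neighbourhood `U` in `Z` and a relative automorphism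
of `J²(U)` with respect to `X ∩ U` carrying `F` over `U` to `U × S`. -/
def LocallyJetEquivalentModulo (i : X → Z) (F : Set (JetBundle E₂ Z))
    (S : Set (JetModel (V × W))) : Prop :=
  ∀ x₀ : X, ∃ (e : LocalCoord E₂ Z (V × W)) (y₀ : W),
    i x₀ ∈ e.toHomeo.source ∧ IsAdapted i e y₀ ∧
    ∃ Φ : V × W → RedJet (V × W) ≃L[ℝ] RedJet (V × W),
      IsRelativeJetAutomorphism e.toHomeo.target y₀ Φ ∧
      ∀ (z : e.toHomeo.target) (J : JetModel (V × W)),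
        J ∈ fibre F e z ↔ actJet (Φ z) J ∈ S

end Restriction

end JetRestriction

end


/-
Let `f` be a test function for `u|_X` at `x₀`; adding `ε Q` with `Q` a positive definite quadratic
form in `x - x₀`, and letting `ε → 0` at the end, we may assume `u|_X < f` near `x₀` except at `x₀`.
In adapted coordinates take points `a_N → (x₀, y₀)` where `u` is touched from above by
`ψ_N (x, y) = f x + N q(y) + c_N`, with `q` a positive definite quadratic polynomial vanishing only
at `y₀`. As usual for penalizations, `c_N → 0` and `N q(a_N) → 0`, and the jet of `ψ_N` at `a_N`
lies in `F`, so `i* ∘ Φ` sends it into `i* S`.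

The contribution of `N q` to that image tends to zero. On the slice `y = y₀` the map `i* ∘ Φ` kills
the kernel of `i*`, to which all jets of functions of `y` belong; so off the slice it maps the first
derivative of `N q`, of size `N |y - y₀|`, to size `N |y - y₀|²`, and it maps the Hessian of `N q`
to size `N |y - y₀|²` because `Φ` acts on Hessians by `A ↦ h A hᵗ`, quadratically in `h`. Hence the
images converge to the image of the jet of `f` under `φ`, which lies in the closed set `i* S`.
-/

noncomputable section

namespace JetRestriction

section Forms

variable {V W : Type*} [NormedAddCommGroup V] [NormedSpace ℝ V]
  [NormedAddCommGroup W] [NormedSpace ℝ W]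

theorem SymForm.ext_form {A B : SymForm V} (h : ∀ v w, A.form v w = B.form v w) : A = B :=
  Subtype.ext (ContinuousLinearMap.ext fun v => ContinuousLinearMap.ext fun w => h v w)

theorem SymForm.form_comm (A : SymForm V) (v w : V) : A.form v w = A.form w v :=
  A.2 v w

theorem SymForm.form_pull_apply (ℓ : V →L[ℝ] W) (A : SymForm W) (v w : V) :
    (A.pull ℓ).form v w = A.form (ℓ v) (ℓ w) := rfl

theorem SymForm.norm_pull_le (ℓ : V →L[ℝ] W) (A : SymForm W) :
    ‖A.pull ℓ‖ ≤ ‖ℓ‖ ^ 2 * ‖A‖ := by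
  refine ContinuousLinearMap.opNorm_le_bound₂ (A.pull ℓ).form (by positivity) fun v w => ?_
  calc ‖A.form (ℓ v) (ℓ w)‖ ≤ ‖A‖ * ‖ℓ v‖ * ‖ℓ w‖ := A.form.le_opNorm₂ _ _
    _ ≤ ‖A‖ * (‖ℓ‖ * ‖v‖) * (‖ℓ‖ * ‖w‖) := by gcongr <;> exact ℓ.le_opNorm _
    _ = ‖ℓ‖ ^ 2 * ‖A‖ * ‖v‖ * ‖w‖ := by ring

theorem SymForm.continuous_pull {α : Type*} [TopologicalSpace α] {ℓ : α → V →L[ℝ] W}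
    {A : α → SymForm W} (hℓ : Continuous ℓ) (hA : Continuous A) :
    Continuous fun a => (A a).pull (ℓ a) := by
  have hform : Continuous fun a => (A a).form := SymForm.form.continuous.comp hA
  have hprecomp : Continuous fun a => (ContinuousLinearMap.compL ℝ V W ℝ).flip (ℓ a) :=
    (ContinuousLinearMap.compL ℝ V W ℝ).flip.continuous.comp hℓ
  exact continuous_induced_rng.2 (hprecomp.clm_comp (hform.clm_comp hℓ))

/-- Pull-back of symmetric forms along `ℓ`, as a continuous linear map. -/
def SymForm.pullL (ℓ : V →L[ℝ] W) : SymForm W →L[ℝ] SymForm V :=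
  LinearMap.mkContinuous
    { toFun := SymForm.pull ℓ
      map_add' := fun _ _ => rfl
      map_smul' := fun _ _ => rfl } (‖ℓ‖ ^ 2) (SymForm.norm_pull_le ℓ)

/-- The symmetric part `(B + Bᵗ) / 2` of a bilinear form. -/
def symPart (B : V →L[ℝ] V →L[ℝ] ℝ) : SymForm V :=
  (⟨(1 / 2 : ℝ) • (B + B.flip),
    fun v w => congrArg ((1 / 2 : ℝ) * ·) (add_comm (B v w) (B w v))⟩ : ↥(symSubmodule V))

theorem form_symPart_apply (B : V →L[ℝ] V →L[ℝ] ℝ) (v w : V) :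
    (symPart B).form v w = (1 / 2 : ℝ) * (B v w + B w v) := rfl

theorem norm_symPart_le (B : V →L[ℝ] V →L[ℝ] ℝ) : ‖symPart B‖ ≤ ‖B‖ := by
  refine ContinuousLinearMap.opNorm_le_bound₂ (symPart B).form (norm_nonneg B) fun v w => ?_
  have hvw : ‖B v w‖ ≤ ‖B‖ * ‖v‖ * ‖w‖ := B.le_opNorm₂ v w
  have hwv : ‖B w v‖ ≤ ‖B‖ * ‖w‖ * ‖v‖ := B.le_opNorm₂ w v
  rw [form_symPart_apply, norm_mul, Real.norm_of_nonneg (by norm_num : (0 : ℝ) ≤ 1 / 2)]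
  linarith [norm_add_le (B v w) (B w v)]

/-- The projection `B ↦ (B + Bᵗ) / 2` onto symmetric forms, as a continuous linear map. -/
def symmetrize : (V →L[ℝ] V →L[ℝ] ℝ) →L[ℝ] SymForm V :=
  LinearMap.mkContinuous
    { toFun := symPart
      map_add' := fun B C => SymForm.ext_form fun v w => by
        change (1 / 2 : ℝ) * (B v w + C v w + (B w v + C w v)) =
          (1 / 2 : ℝ) * (B v w + B w v) + (1 / 2 : ℝ) * (C v w + C w v)
        ring
      map_smul' := fun c B => SymForm.ext_form fun v w => by
        change (1 / 2 : ℝ) * (c * B v w + c * B w v) = c * ((1 / 2 : ℝ) * (B v w + B w v))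
        ring } 1 fun B => (norm_symPart_le B).trans_eq (one_mul _).symm

theorem form_symmetrize_apply (B : V →L[ℝ] V →L[ℝ] ℝ) (v w : V) :
    (symmetrize B).form v w = (1 / 2 : ℝ) * (B v w + B w v) := rfl

theorem symmetrize_form (A : SymForm V) : symmetrize A.form = A :=
  SymForm.ext_form fun v w => by
    rw [form_symmetrize_apply, A.form_comm w v]
    ring

theorem form_symmetrize {B : V →L[ℝ] V →L[ℝ] ℝ} (hB : ∀ v w, B v w = B w v) :
    (symmetrize B).form = B :=
  ContinuousLinearMap.ext fun v => ContinuousLinearMap.ext fun w => by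
    rw [form_symmetrize_apply, hB w v]
    ring

theorem pull_symmetrize (ℓ : V →L[ℝ] W) (B : W →L[ℝ] W →L[ℝ] ℝ) :
    (symmetrize B).pull ℓ = symmetrize (B.bilinearComp ℓ ℓ) := rfl

variable (V) in
theorem exists_isCoercive_form [FiniteDimensional ℝ V] :
    ∃ B : SymForm V, IsCoercive B.form := by
  let t : V →L[ℝ] EuclideanSpace ℝ (Fin (Module.finrank ℝ V)) := toEuclidean (E := V)
  let B : SymForm V := (symmetrize (innerSL ℝ)).pull t
  have hB : ∀ v, B.form v v = ‖t v‖ ^ 2 := fun v => by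
    rw [SymForm.form_pull_apply, form_symmetrize (B := innerSL ℝ) fun x y => real_inner_comm y x]
    exact real_inner_self_eq_norm_sq (t v)
  obtain ⟨K, hK, ht⟩ := t.exists_antilipschitzWith
    (LinearMap.ker_eq_bot.2 (toEuclidean (E := V)).injective)
  refine ⟨B, (K : ℝ)⁻¹ ^ 2, by positivity, fun v => ?_⟩
  have hv : ‖v‖ ≤ K * ‖t v‖ := ht.le_mul_norm (map_zero t) v
  calc (K : ℝ)⁻¹ ^ 2 * ‖v‖ * ‖v‖ = ((K : ℝ)⁻¹ * ‖v‖) ^ 2 := by ring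
    _ ≤ ‖t v‖ ^ 2 := by
      gcongr
      rwa [inv_mul_le_iff₀ (by positivity)]
    _ = B.form v v := (hB v).symm

theorem eq_zero_of_pull_eq_zero {B : SymForm W} (hB : IsCoercive B.form) {ℓ : V →L[ℝ] W}
    (h : B.pull ℓ = 0) : ℓ = 0 := by
  obtain ⟨c, hc, hcB⟩ := hB
  ext v
  have hzero : B.form (ℓ v) (ℓ v) = 0 := by rw [← SymForm.form_pull_apply, h]; rfl
  have hle : ‖ℓ v‖ ^ 2 ≤ 0 := by nlinarith [hcB (ℓ v)]
  simpa using le_antisymm hle (by positivity)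

/-- Pull-back of reduced jets along a linear map: `ℓ* (p, A) = (p ∘ ℓ, ℓ* A)`. -/
def pullRed (ℓ : V →L[ℝ] W) : RedJet W →L[ℝ] RedJet V :=
  ((ContinuousLinearMap.compL ℝ V W ℝ).flip ℓ).prodMap (SymForm.pullL ℓ)

theorem pullRed_apply (ℓ : V →L[ℝ] W) (j : RedJet W) :
    pullRed ℓ j = (j.1.comp ℓ, j.2.pull ℓ) := rfl

theorem pullRed_pullRed {U : Type*} [NormedAddCommGroup U] [NormedSpace ℝ U]
    (ℓ : U →L[ℝ] V) (ℓ' : V →L[ℝ] W) (j : RedJet W) :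
    pullRed ℓ (pullRed ℓ' j) = pullRed (ℓ'.comp ℓ) j := rfl

theorem pullRed_zero_left (j : RedJet W) : pullRed (0 : V →L[ℝ] W) j = 0 :=
  Prod.ext (ContinuousLinearMap.comp_zero _) (SymForm.ext_form fun v w => by
    rw [pullRed_apply, SymForm.form_pull_apply]
    simp)

theorem pullRed_inl_pullRed_snd (j : RedJet W) :
    pullRed (ContinuousLinearMap.inl ℝ V W) (pullRed (ContinuousLinearMap.snd ℝ V W) j) = 0 := by
  rw [pullRed_pullRed, ContinuousLinearMap.snd_comp_inl, pullRed_zero_left]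

theorem PosCondition.image_restrictModel {S : Set (JetModel (V × W))} (hS : PosCondition S) :
    PosCondition (restrictModel '' S) := by
  rintro _ _ _ P ⟨⟨r, p, A⟩, hJ, ⟨⟩⟩ hP
  exact ⟨(r, p, A + P.pull (ContinuousLinearMap.fst ℝ V W)), hS r p A _ hJ fun v => hP v.1, rfl⟩

end Forms

section Derivatives

variable {V W : Type*} [NormedAddCommGroup V] [NormedSpace ℝ V]
  [NormedAddCommGroup W] [NormedSpace ℝ W]

/-- The reduced 2-jet of `f` at `x`. Symmetrizing the second derivative makes this total; it changes
nothing if `f` is `C²` near `x`. -/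
def redJetAt (f : V → ℝ) (x : V) : RedJet V :=
  (fderiv ℝ f x, symmetrize (fderiv ℝ (fderiv ℝ f) x))

/-- The 2-jet of `f` at `x`. -/
def jetAt (f : V → ℝ) (x : V) : JetModel V :=
  (f x, redJetAt f x)

theorem redJetAt_congr {f g : V → ℝ} {x : V} (h : f =ᶠ[𝓝 x] g) : redJetAt f x = redJetAt g x := by
  simp only [redJetAt, h.fderiv_eq, h.fderiv.fderiv_eq]

theorem jetAt_congr {f g : V → ℝ} {x : V} (h : f =ᶠ[𝓝 x] g) : jetAt f x = jetAt g x :=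
  Prod.ext h.eq_of_nhds (redJetAt_congr h)

theorem jetAt_eq_jetAt_iff {f g : V → ℝ} {x : V} (hf : ContDiffAt ℝ 2 f x)
    (hg : ContDiffAt ℝ 2 g x) : jetAt f x = jetAt g x ↔ derivs f x = derivs g x := by
  have hform : ∀ {k : V → ℝ}, ContDiffAt ℝ 2 k x →
      (symmetrize (fderiv ℝ (fderiv ℝ k) x)).form = fderiv ℝ (fderiv ℝ k) x := fun hk =>
    form_symmetrize (hk.isSymmSndFDerivAt (by simp)).eq
  simp only [jetAt, redJetAt, derivs, Prod.mk.injEq]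
  refine and_congr_right fun _ => and_congr_right fun _ => ⟨fun h => ?_, congrArg _⟩
  rw [← hform hf, h, hform hg]

theorem differentiableAt_fderiv {F : Type*} [NormedAddCommGroup F] [NormedSpace ℝ F]
    {f : V → F} {x : V} (hf : ContDiffAt ℝ 2 f x) : DifferentiableAt ℝ (fderiv ℝ f) x :=
  (hf.fderiv_right (m := 1) (by norm_num)).differentiableAt (by simp)

theorem redJetAt_add {f g : V → ℝ} {x : V} (hf : ContDiffAt ℝ 2 f x) (hg : ContDiffAt ℝ 2 g x) :
    redJetAt (f + g) x = redJetAt f x + redJetAt g x := by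
  have hfg : fderiv ℝ (f + g) =ᶠ[𝓝 x] fderiv ℝ f + fderiv ℝ g := by
    filter_upwards [hf.eventually (by simp), hg.eventually (by simp)] with y hy hy'
    exact fderiv_add (hy.differentiableAt (by simp)) (hy'.differentiableAt (by simp))
  refine Prod.ext hfg.self_of_nhds ?_
  simp only [redJetAt, Prod.snd_add]
  rw [hfg.fderiv_eq, fderiv_add (differentiableAt_fderiv hf) (differentiableAt_fderiv hg), map_add]

theorem redJetAt_const_smul (c : ℝ) (f : V → ℝ) (x : V) :
    redJetAt (c • f) x = c • redJetAt f x := by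
  have hf : fderiv ℝ (c • f) = c • fderiv ℝ f := fderiv_const_smul_field c
  have hf' : fderiv ℝ (c • fderiv ℝ f) = c • fderiv ℝ (fderiv ℝ f) :=
    fderiv_const_smul_field (f := fderiv ℝ f) c
  simp only [redJetAt, hf, hf', Pi.smul_apply, Prod.smul_mk, map_smul]

theorem redJetAt_add_const_mul {f g : V → ℝ} {x : V} (hf : ContDiffAt ℝ 2 f x)
    (hg : ContDiffAt ℝ 2 g x) (c : ℝ) :
    redJetAt (fun v => f v + c * g v) x = redJetAt f x + c • redJetAt g x :=
  (redJetAt_add hf (hg.const_smul c)).trans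
    (congrArg (redJetAt f x + ·) (redJetAt_const_smul c g x))

theorem redJetAt_add_const (f : V → ℝ) (c : ℝ) (x : V) :
    redJetAt (fun v => f v + c) x = redJetAt f x := by
  have hf : fderiv ℝ (fun v => f v + c) = fderiv ℝ f := funext fun y => fderiv_add_const c
  simp only [redJetAt, hf]

theorem continuousAt_redJetAt {f : V → ℝ} {x : V} (hf : ContDiffAt ℝ 2 f x) :
    ContinuousAt (redJetAt f) x := by
  have hf₁ : ContDiffAt ℝ 1 (fderiv ℝ f) x := hf.fderiv_right (by norm_num)
  have hf₂ : ContDiffAt ℝ 0 (fderiv ℝ (fderiv ℝ f)) x := hf₁.fderiv_right (by norm_num)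
  exact hf₁.continuousAt.prodMk (symmetrize.continuous.continuousAt.comp hf₂.continuousAt)

theorem contDiffAt_quadPoly (x : V) (J : JetModel V) (v : V) :
    ContDiffAt ℝ 2 (quadPoly x J) v :=
  (quadPoly_contDiff x J).contDiffAt.of_le two_le_infty

theorem hasFDerivAt_quadPoly (x : V) (J : JetModel V) (v : V) :
    HasFDerivAt (quadPoly x J) (J.2.1 + J.2.2.form (v - x)) v := by
  have hid : HasFDerivAt (fun w : V => w - x) (ContinuousLinearMap.id ℝ V) v :=
    (hasFDerivAt_id v).sub_const x
  have hlin : HasFDerivAt (fun w => J.2.1 (w - x)) (J.2.1.comp (ContinuousLinearMap.id ℝ V)) v :=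
    J.2.1.hasFDerivAt.comp v hid
  have hform : HasFDerivAt (fun w => J.2.2.form (w - x))
      (J.2.2.form.comp (ContinuousLinearMap.id ℝ V)) v := J.2.2.form.hasFDerivAt.comp v hid
  refine ((hlin.const_add J.1).add ((hform.clm_apply hid).const_mul (1 / 2 : ℝ))).congr_fderiv ?_
  ext w
  change J.2.1 w + (1 / 2 : ℝ) * (J.2.2.form (v - x) w + J.2.2.form w (v - x)) =
    J.2.1 w + J.2.2.form (v - x) w
  rw [J.2.2.form_comm w (v - x)]
  ring

theorem redJetAt_quadPoly (x : V) (J : JetModel V) (v : V) :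
    redJetAt (quadPoly x J) v = (J.2.1 + J.2.2.form (v - x), J.2.2) := by
  have hfst : fderiv ℝ (quadPoly x J) = fun w => J.2.1 + J.2.2.form (w - x) :=
    funext fun w => (hasFDerivAt_quadPoly x J w).fderiv
  have hsnd : HasFDerivAt (fun w => J.2.1 + J.2.2.form (w - x)) J.2.2.form v :=
    (J.2.2.form.hasFDerivAt.comp v ((hasFDerivAt_id v).sub_const x)).const_add _
  simp only [redJetAt, hfst, hsnd.fderiv, symmetrize_form]

theorem jetAt_quadPoly (x : V) (J : JetModel V) : jetAt (quadPoly x J) x = J := by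
  simp [jetAt, redJetAt_quadPoly, quadPoly]

theorem redJetAt_comp {f : W → ℝ} {τ : V → W} {x : V}
    (hf : ContDiffAt ℝ 2 f (τ x)) (hτ : ContDiffAt ℝ 2 τ x) :
    redJetAt (f ∘ τ) x = pullRed (fderiv ℝ τ x) (redJetAt f (τ x)) + (0, symmetrize
      ((ContinuousLinearMap.compL ℝ V W ℝ (fderiv ℝ f (τ x))).comp (fderiv ℝ (fderiv ℝ τ) x))) := by
  have hfst : fderiv ℝ (f ∘ τ) =ᶠ[𝓝 x] fun y => (fderiv ℝ f (τ y)).comp (fderiv ℝ τ y) := by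
    filter_upwards [hτ.eventually (by simp),
      hτ.continuousAt.eventually (hf.eventually (by simp))] with y hy hy'
    exact fderiv_comp y (hy'.differentiableAt (by simp)) (hy.differentiableAt (by simp))
  have hsnd : HasFDerivAt (fun y => fderiv ℝ f (τ y))
      ((fderiv ℝ (fderiv ℝ f) (τ x)).comp (fderiv ℝ τ x)) x :=
    (differentiableAt_fderiv hf).hasFDerivAt.comp x (hτ.differentiableAt (by simp)).hasFDerivAt
  refine Prod.ext (hfst.self_of_nhds.trans (add_zero _).symm) ?_
  change symmetrize (fderiv ℝ (fderiv ℝ (f ∘ τ)) x) = SymForm.pull _ (symmetrize _) + symmetrize _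
  rw [hfst.fderiv_eq, (hsnd.clm_comp (differentiableAt_fderiv hτ).hasFDerivAt).fderiv, map_add,
    add_comm, pull_symmetrize]
  rfl

theorem redJetAt_comp_affine {f : W → ℝ} {τ : V → W} {x : V} {ℓ : V →L[ℝ] W}
    (hf : ContDiffAt ℝ 2 f (τ x)) (hτ : ∀ v, HasFDerivAt τ ℓ v) :
    redJetAt (f ∘ τ) x = pullRed ℓ (redJetAt f (τ x)) := by
  have hτ' : fderiv ℝ τ = fun _ => ℓ := funext fun v => (hτ v).fderiv
  have hτ₂ : ContDiff ℝ (1 + 1) τ := contDiff_succ_iff_fderiv.2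
    ⟨fun v => (hτ v).differentiableAt, by simp, hτ' ▸ contDiff_const⟩
  rw [redJetAt_comp hf (hτ₂.contDiffAt.of_le (by norm_num)), hτ']
  simp

theorem restrictModel_jetAt {f : V × W → ℝ} {x : V} {y : W} (hf : ContDiffAt ℝ 2 f (x, y)) :
    restrictModel (jetAt f (x, y)) = jetAt (fun v => f (v, y)) x :=
  Prod.ext rfl
    (redJetAt_comp_affine (τ := fun v => (v, y)) hf fun v => hasFDerivAt_prodMk_left v y).symm

/-- The jet of `f ∘ τ` when `f` has jet `J`, `τ` has derivative `L` and second derivative `Q`. -/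
def pullModel (L : V →L[ℝ] W) (Q : V →L[ℝ] V →L[ℝ] W) (J : JetModel W) : JetModel V :=
  (J.1, J.2.1.comp L,
    J.2.2.pull L + symmetrize ((ContinuousLinearMap.compL ℝ V W ℝ J.2.1).comp Q))

theorem jetAt_comp {f : W → ℝ} {τ : V → W} {x : V}
    (hf : ContDiffAt ℝ 2 f (τ x)) (hτ : ContDiffAt ℝ 2 τ x) :
    jetAt (f ∘ τ) x = pullModel (fderiv ℝ τ x) (fderiv ℝ (fderiv ℝ τ) x) (jetAt f (τ x)) :=
  Prod.ext rfl ((redJetAt_comp hf hτ).trans (Prod.ext (add_zero _) rfl))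

theorem continuous_pullModel {α : Type*} [TopologicalSpace α] {L : α → V →L[ℝ] W}
    {Q : α → V →L[ℝ] V →L[ℝ] W} {J : α → JetModel W} (hL : Continuous L) (hQ : Continuous Q)
    (hJ : Continuous J) : Continuous fun a => pullModel (L a) (Q a) (J a) := by
  have hp : Continuous fun a => (J a).2.1 := hJ.snd.fst
  have hpull : Continuous fun a => (J a).2.2.pull (L a) :=
    SymForm.continuous_pull hL hJ.snd.snd
  have hpost : Continuous fun a => ContinuousLinearMap.compL ℝ V W ℝ (J a).2.1 :=
    (ContinuousLinearMap.compL ℝ V W ℝ).continuous.comp hp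
  have hsym : Continuous fun a =>
      symmetrize ((ContinuousLinearMap.compL ℝ V W ℝ (J a).2.1).comp (Q a)) :=
    (symmetrize (V := V)).continuous.comp (hpost.clm_comp hQ)
  exact hJ.fst.prodMk ((hp.clm_comp hL).prodMk (hpull.add hsym))

theorem pullModel_add_form (L : V →L[ℝ] W) (Q : V →L[ℝ] V →L[ℝ] W) (r : ℝ) (p : W →L[ℝ] ℝ)
    (A P : SymForm W) : pullModel L Q (r, p, A + P) =
      (r, p.comp L, (pullModel L Q (r, p, A)).2.2 + P.pull L) := by
  have hpull : (A + P).pull L = A.pull L + P.pull L := rfl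
  simp only [pullModel, hpull, add_right_comm]

end Derivatives

section Coordinates

variable {E : Type*} [NormedAddCommGroup E] [NormedSpace ℝ E]
  {M : Type*} [TopologicalSpace M] [ChartedSpace E M]
  {V V' : Type*} [NormedAddCommGroup V] [NormedSpace ℝ V]
  [NormedAddCommGroup V'] [NormedSpace ℝ V']

namespace LocalCoord

theorem contMDiffAt (e : LocalCoord E M V) {z : M} (hz : z ∈ e.toHomeo.source) :
    ContMDiffAt 𝓘(ℝ, E) 𝓘(ℝ, V) ∞ e.toHomeo z :=
  e.smooth.contMDiffAt (e.toHomeo.open_source.mem_nhds hz)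

theorem contMDiffAt_symm (e : LocalCoord E M V) {x : V} (hx : x ∈ e.toHomeo.target) :
    ContMDiffAt 𝓘(ℝ, V) 𝓘(ℝ, E) ∞ e.toHomeo.symm x :=
  e.smooth_symm.contMDiffAt (e.toHomeo.open_target.mem_nhds hx)

theorem contDiffAt_comp_symm (e : LocalCoord E M V) {f : M → ℝ} {x : V}
    (hx : x ∈ e.toHomeo.target)
    (hf : ContMDiffAt 𝓘(ℝ, E) 𝓘(ℝ, ℝ) 2 f (e.toHomeo.symm x)) :
    ContDiffAt ℝ 2 (f ∘ e.toHomeo.symm) x :=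
  (hf.comp x ((e.contMDiffAt_symm hx).of_le two_le_infty)).contDiffAt

theorem contMDiffAt_comp (e : LocalCoord E M V) {g : V → ℝ} {z : M}
    (hz : z ∈ e.toHomeo.source) (hg : ContDiffAt ℝ 2 g (e.toHomeo z)) :
    ContMDiffAt 𝓘(ℝ, E) 𝓘(ℝ, ℝ) 2 (g ∘ e.toHomeo) z :=
  hg.contMDiffAt.comp z ((e.contMDiffAt hz).of_le two_le_infty)

theorem contDiffAt_transition (e : LocalCoord E M V) (e' : LocalCoord E M V') {x : V'}
    (hx : x ∈ e'.toHomeo.target) (hx' : e'.toHomeo.symm x ∈ e.toHomeo.source) :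
    ContDiffAt ℝ ∞ (e.toHomeo ∘ e'.toHomeo.symm) x :=
  ((e.contMDiffAt hx').comp x (e'.contMDiffAt_symm hx)).contDiffAt

theorem comp_toHomeo_comp_symm_eventuallyEq (e : LocalCoord E M V) (g : V → ℝ) {x : V}
    (hx : x ∈ e.toHomeo.target) : (g ∘ e.toHomeo) ∘ e.toHomeo.symm =ᶠ[𝓝 x] g := by
  filter_upwards [e.toHomeo.open_target.mem_nhds hx] with y hy
  simp only [Function.comp_apply, e.toHomeo.right_inv hy]

/-- The change of coordinates for 2-jets: the coordinate expression in `e'`, at the point with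
`e'`-coordinates `x'`, of the jet with coordinate expression `J` in `e`. -/
def changeJet (e : LocalCoord E M V) (e' : LocalCoord E M V') (x' : V') (J : JetModel V) :
    JetModel V' :=
  pullModel (fderiv ℝ (e.toHomeo ∘ e'.toHomeo.symm) x')
    (fderiv ℝ (fderiv ℝ (e.toHomeo ∘ e'.toHomeo.symm)) x') J

theorem continuousAt_changeJet (e : LocalCoord E M V) (e' : LocalCoord E M V')
    {q : V' × JetModel V} (hq : q.1 ∈ e'.toHomeo.target)
    (hq' : e'.toHomeo.symm q.1 ∈ e.toHomeo.source) :
    ContinuousAt (fun q : V' × JetModel V => e.changeJet e' q.1 q.2) q := by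
  have hτ := e.contDiffAt_transition e' hq hq'
  have hfst : ContinuousAt (fderiv ℝ (e.toHomeo ∘ e'.toHomeo.symm)) q.1 :=
    (hτ.fderiv_right (m := ∞) (by simp)).continuousAt
  have hsnd : ContinuousAt (fderiv ℝ (fderiv ℝ (e.toHomeo ∘ e'.toHomeo.symm))) q.1 :=
    ((hτ.fderiv_right (m := ∞) (by simp)).fderiv_right (m := ∞) (by simp)).continuousAt
  have hpull : Continuous fun d : (V' →L[ℝ] V) × (V' →L[ℝ] V' →L[ℝ] V) × JetModel V =>
      pullModel d.1 d.2.1 d.2.2 :=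
    continuous_pullModel continuous_fst continuous_snd.fst continuous_snd.snd
  exact hpull.continuousAt.comp ((hfst.comp continuousAt_fst).prodMk
    ((hsnd.comp continuousAt_fst).prodMk continuousAt_snd))

theorem jetAt_comp_symm (e : LocalCoord E M V) (e' : LocalCoord E M V') {f : M → ℝ} {z : M}
    (hz : z ∈ e.toHomeo.source) (hz' : z ∈ e'.toHomeo.source)
    (hf : ContMDiffAt 𝓘(ℝ, E) 𝓘(ℝ, ℝ) 2 f z) :
    jetAt (f ∘ e'.toHomeo.symm) (e'.toHomeo z) =
      e.changeJet e' (e'.toHomeo z) (jetAt (f ∘ e.toHomeo.symm) (e.toHomeo z)) := by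
  have hx' := e'.toHomeo.map_source hz'
  have hinv := e'.toHomeo.left_inv hz'
  have hinv_mem : e'.toHomeo.symm (e'.toHomeo z) ∈ e.toHomeo.source := by rwa [hinv]
  have hτ : (e.toHomeo ∘ e'.toHomeo.symm) (e'.toHomeo z) = e.toHomeo z := congrArg e.toHomeo hinv
  have hfe : ContDiffAt ℝ 2 (f ∘ e.toHomeo.symm) (e.toHomeo z) :=
    e.contDiffAt_comp_symm (e.toHomeo.map_source hz) (by rwa [e.toHomeo.left_inv hz])
  have hcomp : f ∘ e'.toHomeo.symm =ᶠ[𝓝 (e'.toHomeo z)]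
      (f ∘ e.toHomeo.symm) ∘ (e.toHomeo ∘ e'.toHomeo.symm) := by
    filter_upwards [(e'.toHomeo.continuousAt_symm hx').eventually
      (e.toHomeo.open_source.mem_nhds hinv_mem)] with y hy
    simp only [Function.comp_apply, e.toHomeo.left_inv hy]
  rw [jetAt_congr hcomp, jetAt_comp (hτ ▸ hfe)
    ((e.contDiffAt_transition e' hx' hinv_mem).of_le two_le_infty), hτ, changeJet]

end LocalCoord

theorem jet_eq_jet_iff {f g : M → ℝ} {z : M} (hf : ContMDiffAt 𝓘(ℝ, E) 𝓘(ℝ, ℝ) 2 f z)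
    (hg : ContMDiffAt 𝓘(ℝ, E) 𝓘(ℝ, ℝ) 2 g z) :
    jet E f z hf = jet E g z hg ↔ derivs (f ∘ (chartAt E z).symm) (chartAt E z z) =
      derivs (g ∘ (chartAt E z).symm) (chartAt E z z) :=
  Iff.trans ⟨fun h => eq_of_heq (Sigma.mk.inj_iff.1 h).2, fun h => congrArg (Sigma.mk z) h⟩
    (Quotient.eq (r := jetSetoid E z) (x := ⟨f, hf⟩) (y := ⟨g, hg⟩))

variable [IsManifold 𝓘(ℝ, E) ∞ M]

/-- The preferred chart at `z` as a local coordinate system. -/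
def chartCoord (z : M) : LocalCoord E M E where
  toHomeo := chartAt E z
  smooth := contMDiffOn_chart
  smooth_symm := contMDiffOn_chart_symm

namespace LocalCoord

theorem jet_eq_jet_iff (e : LocalCoord E M V) {f g : M → ℝ} {z : M} (hz : z ∈ e.toHomeo.source)
    (hf : ContMDiffAt 𝓘(ℝ, E) 𝓘(ℝ, ℝ) 2 f z) (hg : ContMDiffAt 𝓘(ℝ, E) 𝓘(ℝ, ℝ) 2 g z) :
    jet E f z hf = jet E g z hg ↔
      jetAt (f ∘ e.toHomeo.symm) (e.toHomeo z) = jetAt (g ∘ e.toHomeo.symm) (e.toHomeo z) := by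
  have hzc : z ∈ (chartCoord (E := E) z).toHomeo.source := mem_chart_source E z
  have hchart : ∀ {k : M → ℝ}, ContMDiffAt 𝓘(ℝ, E) 𝓘(ℝ, ℝ) 2 k z →
      ContDiffAt ℝ 2 (k ∘ (chartAt E z).symm) (chartAt E z z) := fun hk =>
    (chartCoord (E := E) z).contDiffAt_comp_symm (mem_chart_target E z)
      (((chartAt E z).left_inv (mem_chart_source E z)).symm ▸ hk)
  rw [JetRestriction.jet_eq_jet_iff, ← jetAt_eq_jetAt_iff (hchart hf) (hchart hg)]
  constructor <;> intro h
  · rw [(chartCoord z).jetAt_comp_symm e hzc hz hf, (chartCoord z).jetAt_comp_symm e hzc hz hg]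
    exact congrArg _ h
  · refine (e.jetAt_comp_symm (chartCoord z) hz hzc hf).trans (Eq.trans ?_
      (e.jetAt_comp_symm (chartCoord z) hz hzc hg).symm)
    rw [h]

theorem jet_eq_jetOf_iff (e : LocalCoord E M V) (x : e.toHomeo.target) {f : M → ℝ} {z : M}
    (hz : e.toHomeo.symm x = z) (hf : ContMDiffAt 𝓘(ℝ, E) 𝓘(ℝ, ℝ) 2 f z) {J : JetModel V} :
    jet E f z hf = e.jetOf x J ↔ jetAt (f ∘ e.toHomeo.symm) x = J := by
  subst hz
  rw [jetOf, e.jet_eq_jet_iff (e.toHomeo.map_target x.2), e.toHomeo.right_inv x.2,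
    jetAt_congr (e.comp_toHomeo_comp_symm_eventuallyEq _ x.2), jetAt_quadPoly]

theorem jet_mem_iff (e : LocalCoord E M V) (x : e.toHomeo.target) {f : M → ℝ} {z : M}
    (hz : e.toHomeo.symm x = z) (hf : ContMDiffAt 𝓘(ℝ, E) 𝓘(ℝ, ℝ) 2 f z)
    {F : Set (JetBundle E M)} :
    jet E f z hf ∈ F ↔ jetAt (f ∘ e.toHomeo.symm) x ∈ fibre F e x := by
  rw [(e.jet_eq_jetOf_iff x hz hf).2 rfl]
  rfl

theorem mem_fibre_iff_changeJet_mem (e : LocalCoord E M V) (e' : LocalCoord E M V')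
    (x : e.toHomeo.target) (x' : e'.toHomeo.target) (h : e'.toHomeo.symm x' = e.toHomeo.symm x)
    {F : Set (JetBundle E M)} {J : JetModel V} :
    J ∈ fibre F e x ↔ e.changeJet e' x' J ∈ fibre F e' x' := by
  have hx := e.toHomeo.map_target x.2
  have hx' : e'.toHomeo (e.toHomeo.symm x) = x' := by rw [← h, e'.toHomeo.right_inv x'.2]
  have hchange := e.jetAt_comp_symm e' hx (h ▸ e'.toHomeo.map_target x'.2)
    (e.contMDiffAt_quadPoly x J)
  rw [hx', e.toHomeo.right_inv x.2, jetAt_congr (e.comp_toHomeo_comp_symm_eventuallyEq _ x.2),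
    jetAt_quadPoly] at hchange
  rw [← hchange]
  exact e'.jet_mem_iff x' h (e.contMDiffAt_quadPoly x J)

end LocalCoord

theorem IsJetAutomorphism.continuousAt_actJet {D : Set V} {Φ : V → RedJet V ≃L[ℝ] RedJet V}
    (hΦ : IsJetAutomorphism D Φ) (hD : IsOpen D) {q : V × JetModel V} (hq : q.1 ∈ D) :
    ContinuousAt (fun q : V × JetModel V => actJet (Φ q.1) q.2) q := by
  have hΦq : ContinuousAt (fun x => (Φ x : RedJet V →L[ℝ] RedJet V)) q.1 :=
    (hΦ.1.contDiffAt (hD.mem_nhds hq)).continuousAt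
  exact continuousAt_snd.fst.prodMk
    ((hΦq.comp continuousAt_fst).clm_apply continuousAt_snd.snd)

theorem IsJetAutomorphism.posCondition_preimage {D : Set V} {Φ : V → RedJet V ≃L[ℝ] RedJet V}
    (hΦ : IsJetAutomorphism D Φ) {x : V} (hx : x ∈ D) {S : Set (JetModel V)}
    (hS : PosCondition S) : PosCondition (actJet (Φ x) ⁻¹' S) := by
  obtain ⟨-, k, -, hk⟩ := hΦ
  intro r p A P hA hP
  have hadd : Φ x (p, A + P) = Φ x (p, A) + (0, P.pull (k x : V →L[ℝ] V)) := by
    rw [← hk x hx P, ← map_add, Prod.mk_add_mk, add_zero]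
  have hmem := hS r _ _ (P.pull (k x : V →L[ℝ] V)) hA fun v => hP _
  have heq : actJet (Φ x) (r, p, A + P) =
      (r, (Φ x (p, A)).1, (Φ x (p, A)).2 + P.pull (k x : V →L[ℝ] V)) :=
    Prod.ext rfl (hadd.trans (Prod.ext (add_zero _) rfl))
  exact Set.mem_preimage.2 (heq ▸ hmem)

theorem posCondition_preimage_pullModel (L : V' →L[ℝ] V) (Q : V' →L[ℝ] V' →L[ℝ] V)
    {S : Set (JetModel V')} (hS : PosCondition S) : PosCondition (pullModel L Q ⁻¹' S) := by
  intro r p A P hA hP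
  rw [Set.mem_preimage, pullModel_add_form]
  exact hS _ _ _ (P.pull L) hA fun v => hP _

theorem LocallyJetEquivalent.isClosed {F : Set (JetBundle E M)} {S : Set (JetModel V)}
    (h : LocallyJetEquivalent F S) (hS : IsClosed S) : IsClosed F := by
  unfold JetBundle.instTopologicalSpace
  rw [isClosed_iSup_iff]
  intro e
  rw [isClosed_coinduced, isClosed_iff_frequently]
  intro q₀ hq₀
  obtain ⟨e', hz, Φ, hΦ, hFΦ⟩ := h (e.toHomeo.symm q₀.1)
  let toCoord : e.toHomeo.target × JetModel E → V := fun q => e'.toHomeo (e.toHomeo.symm q.1)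
  let toModel : e.toHomeo.target × JetModel E → JetModel V := fun q =>
    actJet (Φ (toCoord q)) (e.changeJet e' (toCoord q) q.2)
  have hmem : ∀ q, e.toHomeo.symm q.1 ∈ e'.toHomeo.source →
      (e.jetOf q.1 q.2 ∈ F ↔ toModel q ∈ S) := fun q hq =>
    (e.mem_fibre_iff_changeJet_mem e' q.1 ⟨_, e'.toHomeo.map_source hq⟩
      (e'.toHomeo.left_inv hq)).trans (hFΦ _ _)
  have hsymm : ContinuousAt (fun q : e.toHomeo.target × JetModel E => e.toHomeo.symm q.1) q₀ :=
    (e.toHomeo.continuousAt_symm q₀.1.2).comp_of_eq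
      (continuous_subtype_val.comp continuous_fst).continuousAt rfl
  have hcoord : ContinuousAt toCoord q₀ := (e'.toHomeo.continuousAt hz).comp_of_eq hsymm rfl
  have hcont : ContinuousAt toModel q₀ := by
    have hx := e'.toHomeo.map_source hz
    have hx' : e'.toHomeo.symm (toCoord q₀) ∈ e.toHomeo.source := by
      rw [e'.toHomeo.left_inv hz]
      exact e.toHomeo.map_target q₀.1.2
    have hchange : ContinuousAt (fun q => e.changeJet e' (toCoord q) q.2) q₀ :=
      (e.continuousAt_changeJet e' (q := (toCoord q₀, q₀.2)) hx hx').comp_of_eq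
        (hcoord.prodMk continuousAt_snd) rfl
    exact (hΦ.continuousAt_actJet e'.toHomeo.open_target (q := (toCoord q₀, _)) hx).comp_of_eq
      (hcoord.prodMk hchange) rfl
  have hfreq : ∃ᶠ q in 𝓝 q₀, toModel q ∈ S :=
    (hq₀.and_eventually (hsymm.eventually (e'.toHomeo.open_source.mem_nhds hz))).mono
      fun q hq => (hmem q hq.2).1 hq.1
  exact (hmem q₀ hz).2 (hS.mem_of_frequently_of_tendsto hfreq hcont)

theorem LocallyJetEquivalent.isSubequation {F : Set (JetBundle E M)} {S : Set (JetModel V)}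
    (h : LocallyJetEquivalent F S) (hS : IsConstSubequation S) : IsSubequation F := by
  refine ⟨h.isClosed hS.1, fun e x => ?_⟩
  obtain ⟨e', hz, Φ, hΦ, hFΦ⟩ := h (e.toHomeo.symm x)
  let x' : e'.toHomeo.target := ⟨e'.toHomeo (e.toHomeo.symm x), e'.toHomeo.map_source hz⟩
  have hfibre : fibre F e x = e.changeJet e' x' ⁻¹' (actJet (Φ x') ⁻¹' S) :=
    Set.ext fun J => (e.mem_fibre_iff_changeJet_mem e' x x' (e'.toHomeo.left_inv hz)).trans
      (hFΦ x' _)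
  rw [hfibre]
  exact posCondition_preimage_pullModel _ _ (hΦ.posCondition_preimage x'.2 hS.2)

end Coordinates

section Slice

variable {E₁ E₂ : Type*} [NormedAddCommGroup E₁] [NormedSpace ℝ E₁]
  [NormedAddCommGroup E₂] [NormedSpace ℝ E₂]
  {X Z : Type*} [TopologicalSpace Z] [ChartedSpace E₂ Z]
  {V W : Type*} [NormedAddCommGroup V] [NormedSpace ℝ V]
  [NormedAddCommGroup W] [NormedSpace ℝ W]
  {i : X → Z} {e : LocalCoord E₂ Z (V × W)} {y₀ : W}

/-- The point of `X` with adapted coordinates `(v, y₀)`; junk if there is none. -/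
def slicePoint [Nonempty X] (i : X → Z) (e : LocalCoord E₂ Z (V × W)) (y₀ : W) (v : V) : X :=
  Function.invFun i (e.toHomeo.symm (v, y₀))

theorem IsAdapted.map_slicePoint [Nonempty X] (he : IsAdapted i e y₀) {v : V}
    (hv : (v, y₀) ∈ e.toHomeo.target) : i (slicePoint i e y₀ v) = e.toHomeo.symm (v, y₀) :=
  Function.invFun_eq ((he _ (e.toHomeo.map_target hv)).2 (by rw [e.toHomeo.right_inv hv]))

theorem IsAdapted.mk_fst_toHomeo (he : IsAdapted i e y₀) {x : X} (hx : i x ∈ e.toHomeo.source) :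
    ((e.toHomeo (i x)).1, y₀) = e.toHomeo (i x) :=
  Prod.ext rfl ((he _ hx).1 ⟨x, rfl⟩).symm

theorem LocalCoord.isOpen_slice_target (e : LocalCoord E₂ Z (V × W)) (y₀ : W) :
    IsOpen {v : V | (v, y₀) ∈ e.toHomeo.target} :=
  e.toHomeo.open_target.preimage (by fun_prop)

variable [TopologicalSpace X] [ChartedSpace E₁ X]

theorem IsAdapted.continuousOn_slicePoint [Nonempty X] (he : IsAdapted i e y₀)
    (hi : Topology.IsEmbedding i) :
    ContinuousOn (slicePoint i e y₀) {v | (v, y₀) ∈ e.toHomeo.target} := by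
  rw [hi.isInducing.continuousOn_iff]
  have hsymm : ContinuousOn (fun v : V => e.toHomeo.symm (v, y₀))
      {v | (v, y₀) ∈ e.toHomeo.target} :=
    e.toHomeo.continuousOn_symm.comp (by fun_prop) fun _ hv => hv
  exact hsymm.congr fun v hv => he.map_slicePoint hv

/-- The coordinates `x` on `X` obtained from adapted coordinates `(x, y)` on `Z`, as a
homeomorphism of open sets. -/
def IsAdapted.sliceHomeo [Nonempty X] (he : IsAdapted i e y₀) (hi : Topology.IsEmbedding i) :
    OpenPartialHomeomorph X V where
  toFun x := (e.toHomeo (i x)).1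
  invFun := slicePoint i e y₀
  source := i ⁻¹' e.toHomeo.source
  target := {v | (v, y₀) ∈ e.toHomeo.target}
  map_source' x hx := by
    rw [Set.mem_ofPred_eq, he.mk_fst_toHomeo hx]
    exact e.toHomeo.map_source hx
  map_target' v hv := by
    rw [Set.mem_preimage, he.map_slicePoint hv]
    exact e.toHomeo.map_target hv
  left_inv' x hx := hi.injective <| by
    rw [he.map_slicePoint, he.mk_fst_toHomeo hx, e.toHomeo.left_inv hx]
    exact he.mk_fst_toHomeo hx ▸ e.toHomeo.map_source hx
  right_inv' v hv := by rw [he.map_slicePoint hv, e.toHomeo.right_inv hv]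
  open_source := e.toHomeo.open_source.preimage hi.continuous
  open_target := e.isOpen_slice_target y₀
  continuousOn_toFun := continuous_fst.comp_continuousOn
    (e.toHomeo.continuousOn.comp hi.continuous.continuousOn fun _ hx => hx)
  continuousOn_invFun := he.continuousOn_slicePoint hi

/-- Adapted coordinates `(x, y)` on `Z` restrict to smooth coordinates `x` on the slice `X`. -/
def IsAdapted.sliceCoord [Nonempty X] (he : IsAdapted i e y₀)
    (hi : Manifold.IsSmoothEmbedding 𝓘(ℝ, E₁) 𝓘(ℝ, E₂) ∞ i) : LocalCoord E₁ X V where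
  toHomeo := he.sliceHomeo hi.isEmbedding
  smooth := contDiff_fst.contMDiff.comp_contMDiffOn
    (e.smooth.comp hi.contMDiff.contMDiffOn fun _ hx => hx)
  smooth_symm v hv := by
    -- Smoothness into `X` may be tested in `Z`, since `i` is an immersion.
    refine ((ContMDiffAt.iff_comp_isImmersionAt (hi.isImmersion.isImmersionAt _)).2
      ⟨(he.sliceHomeo hi.isEmbedding).continuousAt_symm hv, ?_⟩).contMDiffWithinAt
    have hslice : ContMDiffAt 𝓘(ℝ, V) 𝓘(ℝ, V × W) ∞ (fun v : V => (v, y₀)) v :=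
      (contDiff_prodMk_left y₀).contMDiff.contMDiffAt
    refine ((e.contMDiffAt_symm hv).comp v hslice).congr_of_eventuallyEq ?_
    filter_upwards [(e.isOpen_slice_target y₀).mem_nhds hv] with w hw
    exact he.map_slicePoint hw

theorem IsAdapted.jetAt_comp_sliceCoord_symm [Nonempty X] (he : IsAdapted i e y₀)
    (hi : Manifold.IsSmoothEmbedding 𝓘(ℝ, E₁) 𝓘(ℝ, E₂) ∞ i) {f : Z → ℝ} {x : V}
    (hx : (x, y₀) ∈ e.toHomeo.target)
    (hf : ContMDiffAt 𝓘(ℝ, E₂) 𝓘(ℝ, ℝ) 2 f (e.toHomeo.symm (x, y₀))) :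
    jetAt ((f ∘ i) ∘ (he.sliceCoord hi).toHomeo.symm) x =
      restrictModel (jetAt (f ∘ e.toHomeo.symm) (x, y₀)) := by
  rw [restrictModel_jetAt (e.contDiffAt_comp_symm hx hf)]
  refine jetAt_congr ?_
  filter_upwards [(e.isOpen_slice_target y₀).mem_nhds hx] with v hv
  exact congrArg f (he.map_slicePoint hv)

variable [IsManifold 𝓘(ℝ, E₁) ∞ X] [IsManifold 𝓘(ℝ, E₂) ∞ Z]

theorem jet_mem_restrictSet_iff (hi : ContMDiff 𝓘(ℝ, E₁) 𝓘(ℝ, E₂) ∞ i)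
    {F : Set (JetBundle E₂ Z)} {g : X → ℝ} {x : X} (hg : ContMDiffAt 𝓘(ℝ, E₁) 𝓘(ℝ, ℝ) 2 g x) :
    jet E₁ g x hg ∈ restrictSet i hi F ↔
      ∃ (f : Z → ℝ) (hf : ContMDiffAt 𝓘(ℝ, E₂) 𝓘(ℝ, ℝ) 2 f (i x)), jet E₂ f (i x) hf ∈ F ∧
        jet E₁ (f ∘ i) x (hf.comp x ((hi x).of_le two_le_infty)) = jet E₁ g x hg := by
  constructor
  · rintro ⟨j, hj, hj'⟩
    induction j using Quotient.inductionOn with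
    | h f => exact ⟨f.1, f.2, hj, congrArg (Sigma.mk x) hj'⟩
  · rintro ⟨f, hf, hfF, h⟩
    exact ⟨Quotient.mk (jetSetoid E₂ (i x)) ⟨f, hf⟩, hfF, eq_of_heq (Sigma.mk.inj_iff.1 h).2⟩

theorem IsAdapted.fibre_restrictSet [Nonempty X] (he : IsAdapted i e y₀)
    (hi : Manifold.IsSmoothEmbedding 𝓘(ℝ, E₁) 𝓘(ℝ, E₂) ∞ i)
    (F : Set (JetBundle E₂ Z)) (x : (he.sliceCoord hi).toHomeo.target) :
    fibre (restrictSet i hi.contMDiff F) (he.sliceCoord hi) x =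
      restrictModel '' fibre F e ⟨(x, y₀), x.2⟩ := by
  let c := he.sliceCoord hi
  let z : e.toHomeo.target := ⟨(x, y₀), x.2⟩
  have hz : i (c.toHomeo.symm x) = e.toHomeo.symm z := he.map_slicePoint x.2
  ext J
  change jet E₁ _ _ (c.contMDiffAt_quadPoly x J) ∈ restrictSet i hi.contMDiff F ↔ _
  rw [jet_mem_restrictSet_iff]
  constructor
  · rintro ⟨f, hf, hfF, h⟩
    refine ⟨_, (e.jet_mem_iff z hz.symm hf).1 hfF, ?_⟩
    rw [← he.jetAt_comp_sliceCoord_symm hi x.2 (hz ▸ hf)]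
    exact (c.jet_eq_jetOf_iff x rfl _).1 h
  · rintro ⟨K, hK, rfl⟩
    have hK' : jetAt ((quadPoly (z : V × W) K ∘ e.toHomeo) ∘ e.toHomeo.symm) z = K := by
      rw [jetAt_congr (e.comp_toHomeo_comp_symm_eventuallyEq _ z.2), jetAt_quadPoly]
    refine ⟨_, hz.symm ▸ e.contMDiffAt_quadPoly z K,
      (e.jet_mem_iff z hz.symm _).2 (hK'.symm ▸ hK), (c.jet_eq_jetOf_iff x rfl _).2 ?_⟩
    rw [he.jetAt_comp_sliceCoord_symm hi x.2 (e.contMDiffAt_quadPoly z K), hK']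

theorem actJet_symm_actJet (Φ : RedJet V ≃L[ℝ] RedJet V) (J : JetModel V) :
    actJet Φ.symm (actJet Φ J) = J :=
  Prod.ext rfl (Φ.symm_apply_apply J.2)

theorem actJet_actJet_symm (Φ : RedJet V ≃L[ℝ] RedJet V) (J : JetModel V) :
    actJet Φ (actJet Φ.symm J) = J :=
  Prod.ext rfl (Φ.apply_symm_apply J.2)

theorem restrictModel_image_preimage_actJet {Φ : RedJet (V × W) ≃L[ℝ] RedJet (V × W)}
    {φ : RedJet V ≃L[ℝ] RedJet V}
    (hΦφ : ∀ J, restrictModel (actJet Φ J) = actJet φ (restrictModel J))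
    (S : Set (JetModel (V × W))) :
    restrictModel '' (actJet Φ ⁻¹' S) = actJet φ ⁻¹' (restrictModel '' S) := by
  ext J
  constructor
  · rintro ⟨K, hK, rfl⟩
    exact ⟨_, hK, hΦφ K⟩
  · rintro ⟨K, hK, hKJ⟩
    refine ⟨actJet Φ.symm K, Set.mem_preimage.2 ((actJet_actJet_symm Φ K).symm ▸ hK), ?_⟩
    rw [← actJet_symm_actJet φ (restrictModel _), ← hΦφ, actJet_actJet_symm, hKJ,
      actJet_symm_actJet]

theorem IsAdapted.mem_fibre_restrictSet_iff [Nonempty X] (he : IsAdapted i e y₀)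
    (hi : Manifold.IsSmoothEmbedding 𝓘(ℝ, E₁) 𝓘(ℝ, E₂) ∞ i)
    {F : Set (JetBundle E₂ Z)} {S : Set (JetModel (V × W))}
    {Φ : V × W → RedJet (V × W) ≃L[ℝ] RedJet (V × W)} {φ : V → RedJet V ≃L[ℝ] RedJet V}
    (hΦφ : ∀ x, (x, y₀) ∈ e.toHomeo.target → ∀ J : JetModel (V × W),
      restrictModel (actJet (Φ (x, y₀)) J) = actJet (φ x) (restrictModel J))
    (hF : ∀ (z : e.toHomeo.target) (J : JetModel (V × W)), J ∈ fibre F e z ↔ actJet (Φ z) J ∈ S)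
    (x : (he.sliceCoord hi).toHomeo.target) (J : JetModel V) :
    J ∈ fibre (restrictSet i hi.contMDiff F) (he.sliceCoord hi) x ↔
      actJet (φ x) J ∈ restrictModel '' S := by
  have hfibre : fibre F e ⟨(x, y₀), x.2⟩ = actJet (Φ (x, y₀)) ⁻¹' S := Set.ext fun K => hF _ K
  rw [he.fibre_restrictSet hi, hfibre, restrictModel_image_preimage_actJet (hΦφ x x.2),
    Set.mem_preimage]

theorem LocallyJetEquivalentModulo.locallyJetEquivalent_restrictSet
    (hi : Manifold.IsSmoothEmbedding 𝓘(ℝ, E₁) 𝓘(ℝ, E₂) ∞ i)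
    {F : Set (JetBundle E₂ Z)} {S : Set (JetModel (V × W))}
    (hFS : LocallyJetEquivalentModulo i F S) :
    LocallyJetEquivalent (restrictSet i hi.contMDiff F) (restrictModel '' S) := by
  intro x₀
  have : Nonempty X := ⟨x₀⟩
  obtain ⟨e, y₀, hx₀, he, Φ, ⟨-, φ, hφ, hΦφ⟩, hF⟩ := hFS x₀
  exact ⟨he.sliceCoord hi, hx₀, φ, hφ, he.mem_fibre_restrictSet_iff hi hΦφ hF⟩

end Slice

section Penalization

open Filter

variable {α : Type*} [TopologicalSpace α]

theorem eventually_forall_lt_add_mul {K : Set α} (hK : IsCompact K) {u : α → EReal}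
    (hu : UpperSemicontinuousOn u K) (hu' : ∀ z ∈ K, u z < ⊤) {g q : α → ℝ}
    (hg : ContinuousOn g K) (hq : ContinuousOn q K) (hq₀ : ∀ z ∈ K, 0 ≤ q z)
    (hlt : ∀ z ∈ K, q z = 0 → u z < g z) :
    ∀ᶠ N : ℝ in atTop, ∀ z ∈ K, u z < ((g z + N * q z : ℝ) : EReal) := by
  suffices h : ∀ᶠ N : ℝ in atTop, ∀ z ∈ K, z ∈ K → u z < ((g z + N * q z : ℝ) : EReal) by
    filter_upwards [h] with N hN z hz using hN z hz hz
  refine hK.induction_on (p := fun s => ∀ᶠ N : ℝ in atTop, ∀ z ∈ s, z ∈ K →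
    u z < ((g z + N * q z : ℝ) : EReal)) (.of_forall fun _ _ h => h.elim)
    (fun s t hst ht => ht.mono fun N hN z hz => hN z (hst hz))
    (fun s t hs ht => ?_) fun z hz => ?_
  · filter_upwards [hs, ht] with N hNs hNt z hz using hz.elim (hNs z) (hNt z)
  obtain ⟨N₀, hN₀⟩ : ∃ N₀ : ℝ, u z < ((g z + N₀ * q z : ℝ) : EReal) := by
    rcases eq_or_ne (q z) 0 with h | h
    · exact ⟨0, by simpa using hlt z hz h⟩
    · obtain ⟨c, hc, -⟩ := EReal.lt_iff_exists_real_btwn.1 (hu' z hz)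
      exact ⟨(c - g z) / q z, by rwa [div_mul_cancel₀ _ h, add_sub_cancel]⟩
  obtain ⟨c, huc, hc⟩ := EReal.lt_iff_exists_real_btwn.1 hN₀
  have hnear : ∀ᶠ w in 𝓝[K] z, c < g w + N₀ * q w :=
    (hg.add (continuousOn_const.mul hq) z hz).eventually (lt_mem_nhds (EReal.coe_lt_coe_iff.1 hc))
  refine ⟨_, (hu z hz c huc).and hnear, ?_⟩
  filter_upwards [eventually_ge_atTop N₀] with N hN w hw hwK
  refine hw.1.trans (EReal.coe_lt_coe_iff.2 (hw.2.trans_le ?_))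
  gcongr
  exact hq₀ w hwK

theorem exists_translate_touching_above {K : Set α} (hK : IsCompact K) {u : α → EReal}
    (hu : UpperSemicontinuousOn u K) (hu' : ∀ z ∈ K, u z < ⊤) {P : α → ℝ}
    (hP : ContinuousOn P K) (hPu : ∃ z ∈ K, (P z : EReal) ≤ u z) :
    ∃ a ∈ K, ∃ c : ℝ, 0 ≤ c ∧ u a = ((P a + c : ℝ) : EReal) ∧
      ∀ w ∈ K, u w ≤ ((P w + c : ℝ) : EReal) := by
  obtain ⟨z₀, hz₀, hle⟩ := hPu
  have hsc : UpperSemicontinuousOn (fun w => u w + ((-P w : ℝ) : EReal)) K :=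
    hu.add' (continuous_coe_real_ereal.comp_continuousOn hP.neg).upperSemicontinuousOn
      fun _ _ => EReal.continuousAt_add (by simp) (by simp)
  obtain ⟨a, haK, ha⟩ := hsc.exists_isMaxOn ⟨z₀, hz₀⟩ hK
  have hmax : ∀ w ∈ K, u w + ((-P w : ℝ) : EReal) ≤ u a + ((-P a : ℝ) : EReal) := fun w hw => ha hw
  have h0 : 0 ≤ u a + ((-P a : ℝ) : EReal) := by
    refine le_trans ?_ (hmax z₀ hz₀)
    rw [EReal.coe_neg, ← sub_eq_add_neg]
    exact (EReal.sub_nonneg (.inr (by simp)) (.inr (by simp))).2 hle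
  have hbot : u a ≠ ⊥ := by
    rintro h
    simp [h] at h0
  lift u a to ℝ using ⟨(hu' a haK).ne, hbot⟩ with r hr
  have h0' : 0 ≤ r + -P a := by exact_mod_cast h0
  refine ⟨a, haK, r + -P a, h0', by rw [← hr]; simp, fun w hw => ?_⟩
  have hw' := hmax w hw
  rw [EReal.coe_neg, ← sub_eq_add_neg, EReal.sub_le_iff_le_add (by simp) (by simp), add_comm] at hw'
  exact_mod_cast hw'

theorem tendsto_of_penalized_le {K : Set α} (hK : IsCompact K) {u : α → EReal}
    (hu : UpperSemicontinuousOn u K) (hu' : ∀ z ∈ K, u z < ⊤) {g q : α → ℝ}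
    (hg : ContinuousOn g K) (hq : ContinuousOn q K) (hq₀ : ∀ z ∈ K, 0 ≤ q z) {z₀ : α}
    (hlt : ∀ z ∈ K, q z = 0 → z ≠ z₀ → u z < g z) {a : ℝ → α} (haK : ∀ N, a N ∈ K)
    (ha : ∀ N, ((g (a N) + N * q (a N) : ℝ) : EReal) ≤ u (a N)) : Tendsto a atTop (𝓝 z₀) := by
  refine (nhds_basis_opens z₀).tendsto_right_iff.2 fun U ⟨hzU, hU⟩ => ?_
  have hlarge := eventually_forall_lt_add_mul (hK.diff hU) (hu.mono Set.sdiff_subset)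
    (fun z hz => hu' z hz.1) (hg.mono Set.sdiff_subset) (hq.mono Set.sdiff_subset)
    (fun z hz => hq₀ z hz.1) fun z hz hqz => hlt z hz.1 hqz fun h => hz.2 (h ▸ hzU)
  filter_upwards [hlarge] with N hN
  by_contra haU
  exact (hN (a N) ⟨haK N, haU⟩).not_ge (ha N)

theorem tendsto_zero_of_penalized_eq {K : Set α} (hK : IsCompact K) {u : α → EReal}
    (hu : UpperSemicontinuousOn u K) (hu' : ∀ z ∈ K, u z < ⊤) {g q : α → ℝ}
    (hg : ContinuousOn g K) (hq : ContinuousOn q K) (hq₀ : ∀ z ∈ K, 0 ≤ q z)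
    (hle : ∀ z ∈ K, q z = 0 → u z ≤ g z) {a : ℝ → α} (haK : ∀ N, a N ∈ K) {c : ℝ → ℝ}
    (hc : ∀ N, 0 ≤ c N) (hac : ∀ N, u (a N) = ((g (a N) + N * q (a N) + c N : ℝ) : EReal)) :
    Tendsto c atTop (𝓝 0) ∧ Tendsto (fun N => N * q (a N)) atTop (𝓝 0) := by
  have hNq : ∀ᶠ N in atTop, 0 ≤ N * q (a N) :=
    (eventually_ge_atTop 0).mono fun N hN => mul_nonneg hN (hq₀ _ (haK N))
  -- Half of the penalty already suffices to keep `u` below `g + ε`; the other half is the gain.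
  have hsmall : ∀ ε > 0, ∀ᶠ N in atTop, c N + N * q (a N) / 2 < ε := fun ε hε => by
    have hlarge := eventually_forall_lt_add_mul hK hu hu' (g := fun z => g z + ε)
      (hg.add continuousOn_const) (hq.div_const 2)
      (fun z hz => div_nonneg (hq₀ z hz) zero_le_two) fun z hz hqz =>
        (hle z hz (by linarith)).trans_lt (EReal.coe_lt_coe_iff.2 (lt_add_of_pos_right _ hε))
    filter_upwards [hlarge] with N hN
    have h := hN (a N) (haK N)
    rw [hac, EReal.coe_lt_coe_iff] at h
    linarith
  constructor
  · refine tendsto_order.2 ⟨fun b hb => .of_forall fun N => hb.trans_le (hc N), fun b hb => ?_⟩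
    filter_upwards [hsmall b hb, hNq] with N hN hN₀
    linarith
  · refine tendsto_order.2 ⟨fun b hb => hNq.mono fun N hN => hb.trans_le hN, fun b hb => ?_⟩
    filter_upwards [hsmall (b / 2) (half_pos hb)] with N hN
    linarith [hc N]

theorem exists_penalized_touching_above [LocallyCompactSpace α] {u : α → EReal} {g q : α → ℝ}
    {z₀ : α} (hu : ∀ᶠ z in 𝓝 z₀, UpperSemicontinuousAt u z ∧ u z < ⊤)
    (hg : ∀ᶠ z in 𝓝 z₀, ContinuousAt g z) (hq : Continuous q) (hq₀ : ∀ z, 0 ≤ q z)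
    (hqz₀ : q z₀ = 0) (hlt : ∀ᶠ z in 𝓝 z₀, q z = 0 → z ≠ z₀ → u z < g z) (heq : u z₀ = g z₀) :
    ∃ (a : ℝ → α) (c : ℝ → ℝ), Tendsto a atTop (𝓝 z₀) ∧ Tendsto c atTop (𝓝 0) ∧
      Tendsto (fun N => N * q (a N)) atTop (𝓝 0) ∧ ∀ᶠ N in atTop,
        u (a N) = ((g (a N) + N * q (a N) + c N : ℝ) : EReal) ∧
        ∀ᶠ w in 𝓝 (a N), u w ≤ ((g w + N * q w + c N : ℝ) : EReal) := by
  obtain ⟨K, hKz₀, hKsub, hK⟩ := local_compact_nhds (hu.and (hg.and hlt))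
  have huK : UpperSemicontinuousOn u K := fun z hz =>
    (hKsub hz).1.1.upperSemicontinuousWithinAt K
  have huK' : ∀ z ∈ K, u z < ⊤ := fun z hz => (hKsub hz).1.2
  have hgK : ContinuousOn g K := fun z hz => (hKsub hz).2.1.continuousWithinAt
  have hltK : ∀ z ∈ K, q z = 0 → z ≠ z₀ → u z < g z := fun z hz => (hKsub hz).2.2
  have hleK : ∀ z ∈ K, q z = 0 → u z ≤ g z := fun z hz hqz => by
    rcases eq_or_ne z z₀ with rfl | hne
    exacts [heq.le, (hltK z hz hqz hne).le]
  have htouch : ∀ N : ℝ, ∃ a ∈ K, ∃ c : ℝ, 0 ≤ c ∧ u a = ((g a + N * q a + c : ℝ) : EReal) ∧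
      ∀ w ∈ K, u w ≤ ((g w + N * q w + c : ℝ) : EReal) := fun N =>
    exists_translate_touching_above hK huK huK' (hgK.add (hq.const_mul N).continuousOn)
      ⟨z₀, mem_of_mem_nhds hKz₀, by simp [hqz₀, heq]⟩
  choose a haK c hc hac hmax using htouch
  have ha : Tendsto a atTop (𝓝 z₀) :=
    tendsto_of_penalized_le hK huK huK' hgK hq.continuousOn (fun z _ => hq₀ z) hltK haK
      fun N => by
        rw [hac, EReal.coe_le_coe_iff]
        exact le_add_of_nonneg_right (hc N)
  obtain ⟨hc₀, hNq₀⟩ := tendsto_zero_of_penalized_eq hK huK huK' hgK hq.continuousOn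
    (fun z _ => hq₀ z) hleK haK hc hac
  refine ⟨a, c, ha, hc₀, hNq₀, ?_⟩
  filter_upwards [ha.eventually (eventually_mem_nhds_iff.2 hKz₀)] with N hN
  exact ⟨hac N, mem_of_superset hN (hmax N)⟩

end Penalization

section LocalRestriction

open Filter
open ContinuousLinearMap (inl fst snd)

theorem tendsto_slice_projection {α β : Type*} [TopologicalSpace α] [TopologicalSpace β]
    (x₀ : α) (y₀ : β) : Tendsto (fun z : α × β => (z.1, y₀)) (𝓝 (x₀, y₀)) (𝓝 (x₀, y₀)) :=
  Continuous.tendsto' (by fun_prop) _ _ rfl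

variable {V W : Type*} [NormedAddCommGroup V] [NormedSpace ℝ V]
  [NormedAddCommGroup W] [NormedSpace ℝ W] {x₀ : V} {y₀ : W}

theorem exists_norm_le_mul_of_eq_zero_on_slice {G : Type*} [NormedAddCommGroup G] [NormedSpace ℝ G]
    {f : V × W → G} (hf : ContDiffAt ℝ 1 f (x₀, y₀))
    (hf₀ : ∀ᶠ z in 𝓝 (x₀, y₀), f (z.1, y₀) = 0) :
    ∃ L : ℝ, ∀ᶠ z in 𝓝 (x₀, y₀), ‖f z‖ ≤ L * ‖z.2 - y₀‖ := by
  obtain ⟨L, t, ht, hL⟩ := hf.exists_lipschitzOnWith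
  refine ⟨L, ?_⟩
  filter_upwards [ht, tendsto_slice_projection x₀ y₀ ht, hf₀] with z hz hz' hzero
  have h := hL.dist_le_mul z hz _ hz'
  rwa [hzero, dist_zero_right, Prod.dist_eq, dist_self, dist_eq_norm,
    max_eq_right (norm_nonneg _)] at h

theorem exists_norm_apply_sub_le_sq {G G' : Type*} [NormedAddCommGroup G] [NormedSpace ℝ G]
    [NormedAddCommGroup G'] [NormedSpace ℝ G'] {R : V × W → G →L[ℝ] G'}
    (hR : ContDiffAt ℝ 1 R (x₀, y₀)) (ℓ : W →L[ℝ] G)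
    (hR₀ : ∀ᶠ z in 𝓝 (x₀, y₀), ∀ w, R (z.1, y₀) (ℓ w) = 0) :
    ∃ C : ℝ, ∀ᶠ z in 𝓝 (x₀, y₀), ‖R z (ℓ (z.2 - y₀))‖ ≤ C * ‖z.2 - y₀‖ ^ 2 := by
  obtain ⟨L, hL⟩ := exists_norm_le_mul_of_eq_zero_on_slice
    (f := fun z => (R z).comp ℓ) (hR.clm_comp contDiffAt_const)
    (hR₀.mono fun z hz => ContinuousLinearMap.ext hz)
  refine ⟨L, hL.mono fun z hz => ?_⟩
  calc ‖R z (ℓ (z.2 - y₀))‖ ≤ ‖(R z).comp ℓ‖ * ‖z.2 - y₀‖ := ((R z).comp ℓ).le_opNorm _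
    _ ≤ L * ‖z.2 - y₀‖ * ‖z.2 - y₀‖ := by gcongr
    _ = L * ‖z.2 - y₀‖ ^ 2 := by ring

theorem exists_norm_pull_le_sq (B : SymForm W) {T : V × W → V →L[ℝ] W}
    (hT : ContDiffAt ℝ 1 T (x₀, y₀)) (hT₀ : ∀ᶠ z in 𝓝 (x₀, y₀), T (z.1, y₀) = 0) :
    ∃ C : ℝ, ∀ᶠ z in 𝓝 (x₀, y₀), ‖B.pull (T z)‖ ≤ C * ‖z.2 - y₀‖ ^ 2 := by
  obtain ⟨L, hL⟩ := exists_norm_le_mul_of_eq_zero_on_slice hT hT₀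
  refine ⟨L ^ 2 * ‖B‖, hL.mono fun z hz => ?_⟩
  calc ‖B.pull (T z)‖ ≤ ‖T z‖ ^ 2 * ‖B‖ := SymForm.norm_pull_le _ _
    _ ≤ (L * ‖z.2 - y₀‖) ^ 2 * ‖B‖ := by gcongr
    _ = L ^ 2 * ‖B‖ * ‖z.2 - y₀‖ ^ 2 := by ring

variable {D : Set (V × W)} {Φ : V × W → RedJet (V × W) ≃L[ℝ] RedJet (V × W)} {B : SymForm W}

-- `Φ` enters the Hessian part of a penalty jet quadratically, through `T = snd ∘ k ∘ inl`; this is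
-- what makes that part `O(|y - y₀|²)` although the Hessian itself does not tend to zero.
theorem exists_norm_pullRed_inl_hessian_le (hD : D ∈ 𝓝 (x₀, y₀)) (hΦ : IsJetAutomorphism D Φ)
    (hker : ∀ x, (x, y₀) ∈ D → ∀ j, pullRed (inl ℝ V W) j = 0 →
      pullRed (inl ℝ V W) (Φ (x, y₀) j) = 0) (hB : IsCoercive B.form) :
    ∃ C : ℝ, ∀ᶠ z in 𝓝 (x₀, y₀),
      ‖pullRed (inl ℝ V W) (Φ z (pullRed (snd ℝ V W) (0, B)))‖ ≤ C * ‖z.2 - y₀‖ ^ 2 := by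
  obtain ⟨-, k, hk, hΦk⟩ := hΦ
  let T : V × W → V →L[ℝ] W := fun z =>
    (snd ℝ V W).comp ((k z : V × W →L[ℝ] V × W).comp (inl ℝ V W))
  have hΦT : ∀ z ∈ D, pullRed (inl ℝ V W) (Φ z (pullRed (snd ℝ V W) (0, B))) =
      (0, B.pull (T z)) := fun z hz =>
    congrArg (pullRed (inl ℝ V W)) (hΦk z hz (B.pull (snd ℝ V W)))
  have hT : ContDiffAt ℝ 1 T (x₀, y₀) := contDiffAt_const.clm_comp
    (((hk.contDiffAt hD).of_le (by simp)).clm_comp contDiffAt_const)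
  have hT₀ : ∀ x, (x, y₀) ∈ D → T (x, y₀) = 0 := fun x hx => by
    have hzero := hker x hx _ (pullRed_inl_pullRed_snd (0, B))
    rw [hΦT _ hx] at hzero
    exact eq_zero_of_pull_eq_zero hB (congrArg Prod.snd hzero)
  obtain ⟨C, hC⟩ := exists_norm_pull_le_sq B hT
    (((tendsto_slice_projection x₀ y₀).eventually_mem hD).mono fun z hz => hT₀ z.1 hz)
  refine ⟨C, ?_⟩
  filter_upwards [hC, hD] with z hz hzD
  rwa [hΦT z hzD, Prod.norm_mk, norm_zero, max_eq_right (norm_nonneg _)]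

theorem exists_norm_pullRed_inl_penalty_le (hD : D ∈ 𝓝 (x₀, y₀)) (hΦ : IsJetAutomorphism D Φ)
    (hker : ∀ x, (x, y₀) ∈ D → ∀ j, pullRed (inl ℝ V W) j = 0 →
      pullRed (inl ℝ V W) (Φ (x, y₀) j) = 0) (hB : IsCoercive B.form) :
    ∃ C : ℝ, ∀ᶠ z in 𝓝 (x₀, y₀),
      ‖pullRed (inl ℝ V W) (Φ z (pullRed (snd ℝ V W) (B.form (z.2 - y₀), B)))‖ ≤
        C * ‖z.2 - y₀‖ ^ 2 := by
  obtain ⟨C₁, hC₁⟩ := exists_norm_apply_sub_le_sq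
    (R := fun z => (pullRed (inl ℝ V W)).comp (Φ z : RedJet (V × W) →L[ℝ] RedJet (V × W)))
    (ℓ := (pullRed (snd ℝ V W)).comp ((inl ℝ (W →L[ℝ] ℝ) (SymForm W)).comp B.form))
    (contDiffAt_const.clm_comp ((hΦ.1.contDiffAt hD).of_le (by simp)))
    (((tendsto_slice_projection x₀ y₀).eventually_mem hD).mono fun z hz w =>
      hker z.1 hz _ (pullRed_inl_pullRed_snd _))
  obtain ⟨C₂, hC₂⟩ := exists_norm_pullRed_inl_hessian_le hD hΦ hker hB
  refine ⟨C₁ + C₂, ?_⟩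
  filter_upwards [hC₁, hC₂] with z hz₁ hz₂
  have hsplit : ((B.form (z.2 - y₀), B) : RedJet W) = (B.form (z.2 - y₀), 0) + (0, B) := by simp
  rw [hsplit, map_add, map_add, map_add, add_mul]
  exact norm_add_le_of_le hz₁ hz₂

theorem quadPoly_nonneg (hB : IsCoercive B.form) (y : W) : 0 ≤ quadPoly y₀ (0, 0, B) y := by
  obtain ⟨c, hc, hcB⟩ := hB
  have h : 0 ≤ B.form (y - y₀) (y - y₀) := le_trans (by positivity) (hcB _)
  simpa [quadPoly] using h

theorem exists_norm_sub_sq_le_quadPoly (hB : IsCoercive B.form) (y₀ : W) :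
    ∃ C : ℝ, ∀ y, ‖y - y₀‖ ^ 2 ≤ C * quadPoly y₀ (0, 0, B) y := by
  obtain ⟨c, hc, hcB⟩ := hB
  refine ⟨2 / c, fun y => ?_⟩
  have h := hcB (y - y₀)
  simp only [quadPoly, zero_apply, zero_add]
  rw [div_mul_eq_mul_div, le_div_iff₀ hc]
  linarith

theorem quadPoly_eq_zero_iff (hB : IsCoercive B.form) {y : W} :
    quadPoly y₀ (0, 0, B) y = 0 ↔ y = y₀ := by
  refine ⟨fun h => ?_, fun h => by simp [h, quadPoly]⟩
  obtain ⟨C, hC⟩ := exists_norm_sub_sq_le_quadPoly hB y₀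
  have hle := hC y
  rw [h, mul_zero] at hle
  exact sub_eq_zero.1 (norm_eq_zero.1 (pow_eq_zero_iff two_ne_zero |>.1
    (le_antisymm hle (by positivity))))

theorem redJetAt_penalized {g : V → ℝ} {z : V × W} (hg : ContDiffAt ℝ 2 g z.1) (N c : ℝ) (y₀ : W)
    (B : SymForm W) :
    redJetAt (fun w : V × W => g w.1 + N * quadPoly y₀ (0, 0, B) w.2 + c) z =
      pullRed (fst ℝ V W) (redJetAt g z.1) +
        N • pullRed (snd ℝ V W) (B.form (z.2 - y₀), B) := by
  have hq : ContDiffAt ℝ 2 (quadPoly y₀ (0, 0, B) ∘ Prod.snd) z :=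
    (contDiffAt_quadPoly y₀ (0, 0, B) z.2).comp z contDiffAt_snd
  have hadd := redJetAt_add_const_mul (hg.comp z contDiffAt_fst) hq N
  rw [redJetAt_comp_affine hg fun _ => hasFDerivAt_fst,
    redJetAt_comp_affine (contDiffAt_quadPoly y₀ (0, 0, B) z.2) fun _ => hasFDerivAt_snd,
    redJetAt_quadPoly, zero_add] at hadd
  exact (redJetAt_add_const _ c z).trans hadd

theorem tendsto_smul_pullRed_inl_penalty {ι : Type*} {l : Filter ι} (hD : D ∈ 𝓝 (x₀, y₀))
    (hΦ : IsJetAutomorphism D Φ)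
    (hker : ∀ x, (x, y₀) ∈ D → ∀ j, pullRed (inl ℝ V W) j = 0 →
      pullRed (inl ℝ V W) (Φ (x, y₀) j) = 0)
    (hB : IsCoercive B.form) {a : ι → V × W} (ha : Tendsto a l (𝓝 (x₀, y₀))) {N : ι → ℝ}
    (hN : ∀ᶠ t in l, 0 ≤ N t)
    (hNa : Tendsto (fun t => N t * quadPoly y₀ (0, 0, B) (a t).2) l (𝓝 0)) :
    Tendsto (fun t => N t • pullRed (inl ℝ V W) (Φ (a t)
      (pullRed (snd ℝ V W) (B.form ((a t).2 - y₀), B)))) l (𝓝 0) := by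
  obtain ⟨C, hC⟩ := exists_norm_pullRed_inl_penalty_le hD hΦ hker hB
  obtain ⟨C', hC'⟩ := exists_norm_sub_sq_le_quadPoly hB y₀
  have hbound : Tendsto (fun t => |C| * C' * (N t * quadPoly y₀ (0, 0, B) (a t).2)) l (𝓝 0) := by
    simpa using hNa.const_mul (|C| * C')
  refine squeeze_zero_norm' ?_ hbound
  filter_upwards [hN, ha.eventually hC] with t hNt ht
  rw [norm_smul, Real.norm_of_nonneg hNt]
  calc _ ≤ N t * (|C| * ‖(a t).2 - y₀‖ ^ 2) := by
        gcongr
        exact ht.trans (by gcongr; exact le_abs_self C)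
    _ ≤ N t * (|C| * (C' * quadPoly y₀ (0, 0, B) (a t).2)) := by
        gcongr
        exact hC' _
    _ = |C| * C' * (N t * quadPoly y₀ (0, 0, B) (a t).2) := by ring

theorem tendsto_pullRed_inl_penalized {ι : Type*} {l : Filter ι} (hD : D ∈ 𝓝 (x₀, y₀))
    (hΦ : IsJetAutomorphism D Φ) {φ : V → RedJet V ≃L[ℝ] RedJet V}
    (hΦφ : ∀ x, (x, y₀) ∈ D → ∀ j,
      pullRed (inl ℝ V W) (Φ (x, y₀) j) = φ x (pullRed (inl ℝ V W) j))
    (hB : IsCoercive B.form) {a : ι → V × W} (ha : Tendsto a l (𝓝 (x₀, y₀))) {N : ι → ℝ}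
    (hN : ∀ᶠ t in l, 0 ≤ N t)
    (hNa : Tendsto (fun t => N t * quadPoly y₀ (0, 0, B) (a t).2) l (𝓝 0))
    {j : ι → RedJet V} {j₀ : RedJet V} (hj : Tendsto j l (𝓝 j₀)) :
    Tendsto (fun t => pullRed (inl ℝ V W) (Φ (a t) (pullRed (fst ℝ V W) (j t) +
      N t • pullRed (snd ℝ V W) (B.form ((a t).2 - y₀), B)))) l (𝓝 (φ x₀ j₀)) := by
  have htest : Tendsto (fun t => pullRed (inl ℝ V W) (Φ (a t) (pullRed (fst ℝ V W) (j t)))) l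
      (𝓝 (φ x₀ j₀)) := by
    have hΦa : Tendsto (fun t => (Φ (a t) : RedJet (V × W) →L[ℝ] RedJet (V × W))) l
        (𝓝 (Φ (x₀, y₀))) := (hΦ.1.contDiffAt hD).continuousAt.tendsto.comp ha
    have hj' := ((pullRed (fst ℝ V W)).continuous.tendsto j₀).comp hj
    have hlim := ((pullRed (inl ℝ V W)).continuous.tendsto _).comp
      ((isBoundedBilinearMap_apply.continuous.tendsto _).comp (hΦa.prodMk_nhds hj'))
    have hval : φ x₀ j₀ = pullRed (inl ℝ V W) (Φ (x₀, y₀) (pullRed (fst ℝ V W) j₀)) := by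
      rw [hΦφ x₀ (mem_of_mem_nhds hD)]
      rfl
    rw [hval]
    exact hlim
  have hpenalty := tendsto_smul_pullRed_inl_penalty hD hΦ
    (fun x hx j hj => by rw [hΦφ x hx, hj, map_zero]) hB ha hN hNa
  simpa only [map_add, map_smul, add_zero] using htest.add hpenalty

variable [FiniteDimensional ℝ V] [FiniteDimensional ℝ W] {u : V × W → EReal}
  {S : Set (JetModel (V × W))} {φ : V → RedJet V ≃L[ℝ] RedJet V} {f : V → ℝ}

theorem actJet_jetAt_mem_restrictModel_of_lt (hD : D ∈ 𝓝 (x₀, y₀))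
    (hu : ∀ z ∈ D, UpperSemicontinuousAt u z ∧ u z < ⊤)
    (hS : IsClosed (restrictModel '' S)) (hΦ : IsJetAutomorphism D Φ)
    (hΦφ : ∀ x, (x, y₀) ∈ D → ∀ J : JetModel (V × W),
      restrictModel (actJet (Φ (x, y₀)) J) = actJet (φ x) (restrictModel J))
    (hsub : ∀ z ∈ D, ∀ ψ : V × W → ℝ, ContDiffAt ℝ 2 ψ z → (∀ᶠ w in 𝓝 z, u w ≤ (ψ w : EReal)) →
      u z = (ψ z : EReal) → actJet (Φ z) (jetAt ψ z) ∈ S)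
    (hf : ContDiffAt ℝ 2 f x₀) (hlt : ∀ᶠ x in 𝓝 x₀, x ≠ x₀ → u (x, y₀) < (f x : EReal))
    (heq : u (x₀, y₀) = (f x₀ : EReal)) :
    actJet (φ x₀) (jetAt f x₀) ∈ restrictModel '' S := by
  obtain ⟨B, hB⟩ := exists_isCoercive_form W
  let q : V × W → ℝ := fun z => quadPoly y₀ (0, 0, B) z.2
  have hq : ContDiff ℝ 2 q :=
    ((quadPoly_contDiff y₀ (0, 0, B)).of_le two_le_infty).comp contDiff_snd
  have hf₂ : ∀ᶠ x in 𝓝 x₀, ContDiffAt ℝ 2 f x := hf.eventually (by simp)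
  obtain ⟨a, c, ha, hc, hNq, htouch⟩ := exists_penalized_touching_above
    (g := fun z : V × W => f z.1)
    (eventually_of_mem hD hu)
    ((continuous_fst.tendsto (x₀, y₀)).eventually hf₂ |>.mono fun z hz =>
      hz.continuousAt.comp continuousAt_fst)
    hq.continuous (fun z => quadPoly_nonneg hB z.2) ((quadPoly_eq_zero_iff hB).2 rfl)
    ((continuous_fst.tendsto (x₀, y₀)).eventually hlt |>.mono fun z hz hqz hne => by
      obtain ⟨x, y⟩ := z
      obtain rfl : y = y₀ := (quadPoly_eq_zero_iff hB).1 hqz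
      exact hz fun h => hne (congrArg (·, y) h)) heq
  have ha₁ : Tendsto (fun N => (a N).1) atTop (𝓝 x₀) := (continuous_fst.tendsto _).comp ha
  have hvalue : Tendsto (fun N => f (a N).1 + N * q (a N) + c N) atTop (𝓝 (f x₀)) := by
    simpa using ((hf.continuousAt.tendsto.comp ha₁).add hNq).add hc
  have hred := tendsto_pullRed_inl_penalized hD hΦ
    (fun x hx j => congrArg Prod.snd (hΦφ x hx (0, j))) hB ha (eventually_ge_atTop 0) hNq
    ((continuousAt_redJetAt hf).tendsto.comp ha₁)
  refine hS.mem_of_tendsto (hvalue.prodMk_nhds hred) ?_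
  filter_upwards [htouch, ha hD, ha₁.eventually hf₂] with N ⟨hua, hule⟩ haD hfa
  have hψ : ContDiffAt ℝ 2 (fun w : V × W => f w.1 + N * q w + c N) (a N) :=
    ((hfa.comp (a N) contDiffAt_fst).add (contDiffAt_const.mul hq.contDiffAt)).add contDiffAt_const
  refine ⟨_, hsub (a N) haD _ hψ hule hua, Prod.ext rfl ?_⟩
  exact congrArg (fun j => pullRed (inl ℝ V W) (Φ (a N) j))
    (redJetAt_penalized hfa N (c N) y₀ B)

theorem actJet_jetAt_mem_restrictModel (hD : D ∈ 𝓝 (x₀, y₀))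
    (hu : ∀ z ∈ D, UpperSemicontinuousAt u z ∧ u z < ⊤)
    (hS : IsClosed (restrictModel '' S)) (hΦ : IsJetAutomorphism D Φ)
    (hΦφ : ∀ x, (x, y₀) ∈ D → ∀ J : JetModel (V × W),
      restrictModel (actJet (Φ (x, y₀)) J) = actJet (φ x) (restrictModel J))
    (hsub : ∀ z ∈ D, ∀ ψ : V × W → ℝ, ContDiffAt ℝ 2 ψ z → (∀ᶠ w in 𝓝 z, u w ≤ (ψ w : EReal)) →
      u z = (ψ z : EReal) → actJet (Φ z) (jetAt ψ z) ∈ S)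
    (hf : ContDiffAt ℝ 2 f x₀) (hle : ∀ᶠ x in 𝓝 x₀, u (x, y₀) ≤ (f x : EReal))
    (heq : u (x₀, y₀) = (f x₀ : EReal)) :
    actJet (φ x₀) (jetAt f x₀) ∈ restrictModel '' S := by
  obtain ⟨A, hA⟩ := exists_isCoercive_form V
  let Q : V → ℝ := quadPoly x₀ (0, 0, A)
  have hQ : ContDiffAt ℝ 2 Q x₀ := contDiffAt_quadPoly x₀ _ x₀
  have hQx₀ : Q x₀ = 0 := (quadPoly_eq_zero_iff hA).2 rfl
  have hstrict : ∀ ε : ℝ, 0 < ε →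
      actJet (φ x₀) (jetAt (fun x => f x + ε * Q x) x₀) ∈ restrictModel '' S := fun ε hε => by
    refine actJet_jetAt_mem_restrictModel_of_lt hD hu hS hΦ hΦφ hsub
      (hf.add (contDiffAt_const.mul hQ)) (hle.mono fun x hx hne => ?_) (by simp [heq, hQx₀])
    have hpos : 0 < Q x := (quadPoly_nonneg hA x).lt_of_ne fun h =>
      hne ((quadPoly_eq_zero_iff hA).1 h.symm)
    exact hx.trans_lt (EReal.coe_lt_coe_iff.2 (lt_add_of_pos_right _ (mul_pos hε hpos)))
  have hjet : ∀ ε : ℝ, jetAt (fun x => f x + ε * Q x) x₀ =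
      (f x₀, redJetAt f x₀ + ε • redJetAt Q x₀) := fun ε =>
    Prod.ext (by simp [jetAt, hQx₀]) (redJetAt_add_const_mul hf hQ ε)
  have hlim : Tendsto (fun ε : ℝ => actJet (φ x₀) (jetAt (fun x => f x + ε * Q x) x₀)) (𝓝[>] 0)
      (𝓝 (actJet (φ x₀) (jetAt f x₀))) := by
    have hcont : Continuous fun ε : ℝ => (f x₀, φ x₀ (redJetAt f x₀ + ε • redJetAt Q x₀)) := by
      fun_prop
    simp only [hjet]
    simpa [actJet, jetAt] using (hcont.tendsto 0).mono_left nhdsWithin_le_nhds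
  exact hS.mem_of_tendsto hlim (eventually_mem_nhdsWithin.mono hstrict)

end LocalRestriction

section Subharmonic

theorem IsSubharmonic.jetAt_mem_fibre {E : Type*} [NormedAddCommGroup E] [NormedSpace ℝ E]
    {M : Type*} [TopologicalSpace M] [ChartedSpace E M] [IsManifold 𝓘(ℝ, E) ∞ M]
    {V : Type*} [NormedAddCommGroup V] [NormedSpace ℝ V] {F : Set (JetBundle E M)} {u : M → EReal}
    (hu : IsSubharmonic F u) (e : LocalCoord E M V) (x : e.toHomeo.target) {ψ : V → ℝ}
    (hψ : ContDiffAt ℝ 2 ψ x) (hle : ∀ᶠ v in 𝓝 (x : V), u (e.toHomeo.symm v) ≤ (ψ v : EReal))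
    (heq : u (e.toHomeo.symm x) = (ψ x : EReal)) : jetAt ψ x ∈ fibre F e x := by
  have hz := e.toHomeo.map_target x.2
  have hx : e.toHomeo (e.toHomeo.symm x) = x := e.toHomeo.right_inv x.2
  have hC : ContMDiffAt 𝓘(ℝ, E) 𝓘(ℝ, ℝ) 2 (ψ ∘ e.toHomeo) (e.toHomeo.symm x) :=
    e.contMDiffAt_comp hz (hx.symm ▸ hψ)
  have hle' : ∀ᶠ w in 𝓝 (e.toHomeo.symm x), u w ≤ ((ψ ∘ e.toHomeo) w : EReal) := by
    have hcont : Filter.Tendsto e.toHomeo (𝓝 (e.toHomeo.symm x)) (𝓝 x) :=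
      e.toHomeo.symm.tendsto_symm x.2
    filter_upwards [hcont.eventually hle, e.toHomeo.open_source.mem_nhds hz] with w hw hwe
    rwa [e.toHomeo.left_inv hwe] at hw
  have hmem := hu.2.2 _ _ hC hle' (by rw [heq, Function.comp_apply, hx])
  rwa [e.jet_mem_iff x rfl hC,
    jetAt_congr (e.comp_toHomeo_comp_symm_eventuallyEq ψ x.2)] at hmem

variable {E₁ E₂ : Type*} [NormedAddCommGroup E₁] [NormedSpace ℝ E₁]
  [NormedAddCommGroup E₂] [NormedSpace ℝ E₂]
  {X Z : Type*} [TopologicalSpace X] [ChartedSpace E₁ X] [TopologicalSpace Z] [ChartedSpace E₂ Z]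
  [IsManifold 𝓘(ℝ, E₁) ∞ X] [IsManifold 𝓘(ℝ, E₂) ∞ Z]
  {V W : Type*} [NormedAddCommGroup V] [NormedSpace ℝ V] [FiniteDimensional ℝ V]
  [NormedAddCommGroup W] [NormedSpace ℝ W] [FiniteDimensional ℝ W]

theorem IsSubharmonic.restrict {i : X → Z}
    (hi : Manifold.IsSmoothEmbedding 𝓘(ℝ, E₁) 𝓘(ℝ, E₂) ∞ i)
    {F : Set (JetBundle E₂ Z)} {S : Set (JetModel (V × W))}
    (hFS : LocallyJetEquivalentModulo i F S) (hclosed : IsClosed (restrictModel '' S))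
    {u : Z → EReal} (hu : IsSubharmonic F u) :
    IsSubharmonic (restrictSet i hi.contMDiff F) (u ∘ i) := by
  refine ⟨hu.1.comp hi.contMDiff.continuous, fun x => hu.2.1 _, fun x₀ f hf hle heq => ?_⟩
  have : Nonempty X := ⟨x₀⟩
  obtain ⟨e, y₀, hx₀, he, Φ, ⟨hΦ, φ, -, hΦφ⟩, hF⟩ := hFS x₀
  let c := he.sliceCoord hi
  have hc : c.toHomeo.symm (c.toHomeo x₀) = x₀ := c.toHomeo.left_inv hx₀
  let x : c.toHomeo.target := ⟨c.toHomeo x₀, c.toHomeo.map_source hx₀⟩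
  have hslice : ∀ v ∈ c.toHomeo.target, u (e.toHomeo.symm (v, y₀)) = u (i (c.toHomeo.symm v)) :=
    fun v hv => congrArg u (he.map_slicePoint hv).symm
  rw [c.jet_mem_iff x hc hf, he.mem_fibre_restrictSet_iff hi hΦφ hF]
  refine actJet_jetAt_mem_restrictModel (u := u ∘ e.toHomeo.symm)
    (e.toHomeo.open_target.mem_nhds x.2)
    (fun z hz => ⟨fun b hb => (e.toHomeo.continuousAt_symm hz).eventually (hu.1 _ b hb),
      hu.2.1 _⟩) hclosed hΦ hΦφ
    (fun z hz ψ hψ hψle hψeq => (hF ⟨z, hz⟩ _).1 (hu.jetAt_mem_fibre e ⟨z, hz⟩ hψ hψle hψeq))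
    (c.contDiffAt_comp_symm x.2 (hc.symm ▸ hf)) ?_ ?_
  · have hcont : Filter.Tendsto c.toHomeo.symm (𝓝 x) (𝓝 x₀) := c.toHomeo.tendsto_symm hx₀
    filter_upwards [hcont.eventually hle, c.toHomeo.open_target.mem_nhds x.2] with v hv hvc
    exact (hslice v hvc).trans_le hv
  · rw [Function.comp_apply, hslice _ x.2, Function.comp_apply, hc]
    exact heq

end Subharmonic

end JetRestriction

end

open JetRestriction in
theorem theorem10p1_general {E₁ E₂ : Type*} [NormedAddCommGroup E₁] [NormedSpace ℝ E₁]
    [NormedAddCommGroup E₂] [NormedSpace ℝ E₂]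
    {X : Type*} [TopologicalSpace X] [ChartedSpace E₁ X] [IsManifold 𝓘(ℝ, E₁) ∞ X]
    {Z : Type*} [TopologicalSpace Z] [ChartedSpace E₂ Z] [IsManifold 𝓘(ℝ, E₂) ∞ Z]
    {V W : Type*} [NormedAddCommGroup V] [NormedSpace ℝ V] [FiniteDimensional ℝ V]
    [NormedAddCommGroup W] [NormedSpace ℝ W] [FiniteDimensional ℝ W] {i : X → Z}
    (hi : Manifold.IsSmoothEmbedding 𝓘(ℝ, E₁) 𝓘(ℝ, E₂) ∞ i)
    {F : Set (JetBundle E₂ Z)} {S : Set (JetModel (V × W))} (hS : PosCondition S)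
    (hFS : LocallyJetEquivalentModulo i F S) (hclosed : IsClosed (restrictModel '' S)) :
    IsConstSubequation (restrictModel '' S) ∧
    IsSubequation (restrictSet i hi.contMDiff F) ∧
    LocallyJetEquivalent (restrictSet i hi.contMDiff F) (restrictModel '' S) ∧
    ∀ u : Z → EReal, IsSubharmonic F u →
      IsSubharmonic (restrictSet i hi.contMDiff F) (u ∘ i) := by
  have hH : IsConstSubequation (restrictModel '' S) := ⟨hclosed, hS.image_restrictModel⟩
  have hequiv := hFS.locallyJetEquivalent_restrictSet hi
  exact ⟨hH, hequiv.isSubequation hH, hequiv, fun u hu => hu.restrict hi hFS hclosed⟩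

open JetRestriction in
theorem theorem10p1 {n m : ℕ}
    {X : Type*} [TopologicalSpace X] [ChartedSpace (EuclideanSpace ℝ (Fin n)) X]
    [IsManifold 𝓘(ℝ, EuclideanSpace ℝ (Fin n)) ∞ X]
    {Z : Type*} [TopologicalSpace Z] [ChartedSpace (EuclideanSpace ℝ (Fin (n + m))) Z]
    [IsManifold 𝓘(ℝ, EuclideanSpace ℝ (Fin (n + m))) ∞ Z]
    (i : X → Z)
    (hi : Manifold.IsSmoothEmbedding 𝓘(ℝ, EuclideanSpace ℝ (Fin n))
      𝓘(ℝ, EuclideanSpace ℝ (Fin (n + m))) ∞ i)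
    (F : Set (JetBundle (EuclideanSpace ℝ (Fin (n + m))) Z)) (hF : IsSubequation F)
    (S : Set (JetModel (EuclideanSpace ℝ (Fin n) × EuclideanSpace ℝ (Fin m))))
    (hS : IsConstSubequation S)
    (hFS : LocallyJetEquivalentModulo i F S)
    (hclosed : IsClosed (restrictModel '' S)) :
    IsConstSubequation (restrictModel '' S) ∧
    IsSubequation (restrictSet i hi.contMDiff F) ∧
    LocallyJetEquivalent (restrictSet i hi.contMDiff F) (restrictModel '' S) ∧
    ∀ u : Z → EReal, IsSubharmonic F u →
      IsSubharmonic (restrictSet i hi.contMDiff F) (u ∘ i) :=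
  theorem10p1_general hi hS.2 hFS hclosed
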